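/- \textbf{Setting.} Fix $d, M\ge 1$ and put $\mathcal M=\{1,\dots,M\}$. For each $n\ge 1$ let (the index $n$ is suppressed except on $\mathbf Y_n$; all objects below except $d$, $M$ may depend on $n$) $W\subset\mathbb R^d$ be bounded and measurable, let $\mathbf Y_n$ be a marked point process on $\mathbb R^d\times\mathcal M$ (a random locally finite set of pairs $y=(x,i)$, location $x$, mark $i$), observed in $W\times\mathcal M$, and write $\mathrm dy$ for Lebesgue measure times counting measure. For $\beta=(\beta_1^\top,\dots,\beta_M^\top)^\top\in\mathbb R^p$, $\beta_i\in\mathbb R^{b_i}$, $p=\sum_{i=1}^M b_i$, let $$\rho((x,i);\beta)=d(x)\exp\{\beta_i^\top z_i(x)\},$$ with a measurable baseline function $d(\cdot)\ge 0$ on $\mathbb R^d$ and measurable covariates $z_i:\mathbb R^d\to\mathbb R^{b_i}$; let $z(x)=(z_l(x))_{l=1,\dots,p}$ be the vector of all covariates. For a true parameter $\beta^\star\in\mathbb R^p$, $\mathbf Y_n$ has on $W\times\mathcal M$ intensity function $\rho(\cdot;\beta^\star)$ and (cross) pair correlation function $g\geq 0$, i.e. $\mathrm E\,\#\{(y,y')\in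 \mathbf Y_n^2: y\ne y',\,y\in A,\,y'\in B\}=\int_A\int_B\rho(y;\beta^\star)\rho(y';\beta^\star)g(y,y')\,\mathrm dy'\,\mathrm dy$ for measurable $A,B\subseteq W\times\mathcal M$. Let $\mu=\mathrm E\{N(W\times\mathcal M)\}=\int_{W\times\mathcal M}\rho(y;\beta^\star)\,\mathrm dy$ be the expected number of observed points, and $$\ell(\beta)=\sum_{y\in \mathbf Y_n\cap (W\times\mathcal M)}\log\rho(y;\beta)-\int_{W\times\mathcal M}\rho(y;\beta)\,\mathrm dy$$ the Poisson composite log-likelihood; its Hessian $\ell^{(2)}$ is non-random. Let $\{1,\dots,p\}=\bigcup_{g=1}^G\mathcal G_g$ be a partition into groups of cardinalities $\gamma_g$, let $\beta^g=(\beta_l)_{l\in\mathcal G_g}$, and $$Q(\beta)=\mu^{-1}\ell(\beta)-\sum_{g=1}^G\lambda^g\|\beta^g\|-\sum_{l=1}^p\lambda_l|\beta_l|,$$ where $\lambda^g,\lambda_l\ge 0$ may be random and $\|\cdot\|$ is the Euclidean norm. Let $I_0=\{l:\beta^\star_l=0\}$, $I_1=\{l:\beta^\star_l\ne0\}$, $i_1=\#I_1$,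 $\Gamma_1=\{g:\mathcal G_g\cap I_1\neq\emptyset\}$. \textbf{Conditions}, as $n\to\infty$: (C.1) $\mu\to\infty$. (C.2) $p^4/\mu\to0$; $\sup_x|d(x)|<\infty$ for each $n$; $\sup_{n}\sup_{l\le p}\sup_{x\in\mathbb R^d}|z_l(x)|<\infty$; $$\inf_{n}\ \inf_{\|\phi\|=1}\mu^{-1}\phi^\top\{-\ell^{(2)}(\beta^\star)\}\phi>0;$$ and, for every sequence $\beta=\beta_n\in\mathbb R^p$ with $\|\beta-\beta^\star\|=O(\sqrt{p/\mu})$ and for $q=1,3$, $$\int_{W\times\mathcal M}\int_{W\times\mathcal M}\rho(y;\beta)\rho(y';\beta)\,|g(y,y')-1|\,\mathrm dy\,\mathrm dy'=O(\mu),\qquad \sum_{i=1}^M\int_W\|z(x)\|^q\rho((x,i);\beta)\,\mathrm dx=O(p^{q/2}\mu).$$ (C.3) $\bigl(\max_{l\in I_1}\lambda_l\bigr)\sqrt{i_1\mu/p}=o_{\mathrm P}(1)$ and $\bigl(\max_{g\in\Gamma_1}\lambda^g\bigr)\sqrt{\bigl(\sum_{g\in\Gamma_1}\gamma_g\bigr)\mu/p}=o_{\mathrm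 P}(1)$ (a maximum over the empty set is $0$). (C.4) $\bigl(1/\inf_{l\in I_0}\lambda_l\bigr)\sqrt{p^2/\mu}=o_{\mathrm P}(1)$ (with $1/0=\infty$, $\inf\emptyset=\infty$, $1/\infty=0$). \textbf{Theorem.} Assume (C.1)--(C.4), and let $\hat\beta$ be any estimator that maximizes $Q$ over $\mathbb R^p$ whenever $Q$ has a maximizer. Then, as $n\to\infty$, (i) $\|\hat\beta-\beta^\star\|=O_{\mathrm P}(\sqrt{p/\mu})$; (ii) $\mathrm P(\hat\beta_{I_0}=0)\to1$, i.e. $\mathrm P(\hat\beta_l=0 \text{ for all } l\in I_0)\to 1$. -/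

import Mathlib

open MeasureTheory Filter Topology
open scoped ENNReal NNReal

noncomputable section

namespace SparseGroupLassoPP

/-! ### Marked point processes -/

/-- The space `ℝ^d`. -/
abbrev Space (d : ℕ) : Type := EuclideanSpace ℝ (Fin d)

/-- Marked points `y = (x, i)` with location `x ∈ ℝ^d` and mark `i ∈ {1, …, M}`. -/
abbrev MarkedPoint (d M : ℕ) : Type := Space d × Fin M

/-- The reference measure `dy` on marked points: Lebesgue measure times counting measure. -/
def refMeasure (d M : ℕ) : Measure (MarkedPoint d M) :=
  (volume : Measure (Space d)).prod Measure.count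

/-- `Y` is a (simple) marked point process: a random locally finite set of marked points whose
counts are random variables. The component `X_i` is `{x | (x, i) ∈ Y ω}`. -/
structure IsPointProcess {d M : ℕ} {Ω : Type*} [MeasurableSpace Ω]
    (Y : Ω → Set (MarkedPoint d M)) : Prop where
  locallyFinite : ∀ (ω : Ω) (B : Set (Space d)), Bornology.IsBounded B →
    (Y ω ∩ B ×ˢ (Set.univ : Set (Fin M))).Finite
  measurable_count : ∀ A : Set (MarkedPoint d M), MeasurableSet A →
    Measurable fun ω => (((Y ω ∩ A).encard : ℕ∞) : ℝ≥0∞)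

/-- The expected number `E N(A)` of points of `Y` in `A`. -/
def expectedCount {d M : ℕ} {Ω : Type*} [MeasurableSpace Ω] (P : Measure Ω)
    (Y : Ω → Set (MarkedPoint d M)) (A : Set (MarkedPoint d M)) : ℝ≥0∞ :=
  ∫⁻ ω, (((Y ω ∩ A).encard : ℕ∞) : ℝ≥0∞) ∂P

/-- `ρ` is the intensity function of `Y` on `S`: `E N(A) = ∫_A ρ(y) dy` for all measurable
`A ⊆ S`. -/
def HasIntensity {d M : ℕ} {Ω : Type*} [MeasurableSpace Ω] (P : Measure Ω)
    (Y : Ω → Set (MarkedPoint d M)) (S : Set (MarkedPoint d M))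
    (ρ : MarkedPoint d M → ℝ) : Prop :=
  ∀ A ⊆ S, MeasurableSet A →
    expectedCount P Y A = ∫⁻ y in A, ENNReal.ofReal (ρ y) ∂(refMeasure d M)

/-- `g` is the (cross) pair correlation function of `Y` on `S` relative to the intensity `ρ`:
`E #{(y, y') ∈ Y × Y : y ≠ y', y ∈ A, y' ∈ B} = ∫_A ∫_B ρ(y) ρ(y') g(y, y') dy' dy`
for all measurable `A, B ⊆ S`. -/
structure HasPairCorrelation {d M : ℕ} {Ω : Type*} [MeasurableSpace Ω] (P : Measure Ω)
    (Y : Ω → Set (MarkedPoint d M)) (S : Set (MarkedPoint d M))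
    (ρ : MarkedPoint d M → ℝ) (g : MarkedPoint d M → MarkedPoint d M → ℝ) : Prop where
  measurable : Measurable (Function.uncurry g)
  nonneg : ∀ y y', 0 ≤ g y y'
  factorial_moment : ∀ A ⊆ S, ∀ B ⊆ S, MeasurableSet A → MeasurableSet B →
    ∫⁻ ω, ((((Y ω).offDiag ∩ A ×ˢ B).encard : ℕ∞) : ℝ≥0∞) ∂P
      = ∫⁻ y in A, ∫⁻ y' in B, ENNReal.ofReal (ρ y * ρ y' * g y y')
          ∂(refMeasure d M) ∂(refMeasure d M)

/-! ### The log-linear model -/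

/-- The non-random ingredients of the model (at one index `n`): observation window, numbers of
covariates per mark, baseline function, covariates, and the partition of the coefficients into
groups. The coefficients `l ∈ {1, …, p}` are indexed by the pairs `(i, j)` with mark `i` and
`1 ≤ j ≤ b_i`. -/
structure Design (d M : ℕ) where
  /-- the observation window -/
  W : Set (Space d)
  measurableSet_W : MeasurableSet W
  isBounded_W : Bornology.IsBounded W
  /-- the number `b_i` of covariates for mark `i` -/
  b : Fin M → ℕ
  /-- the baseline function `d(x)` -/
  base : Space d → ℝ
  measurable_base : Measurable base
  base_nonneg : ∀ x, 0 ≤ base x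
  /-- the covariates: `z ⟨i, j⟩ x` is the `j`-th entry of `z_i(x)` -/
  z : ((i : Fin M) × Fin (b i)) → Space d → ℝ
  measurable_z : ∀ l, Measurable (z l)
  /-- the number of groups -/
  G : ℕ
  /-- the group to which a coefficient belongs -/
  grp : ((i : Fin M) × Fin (b i)) → Fin G

namespace Design

variable {d M : ℕ} (D : Design d M)

/-- The index set of the coefficients. -/
abbrev Coef : Type := (i : Fin M) × Fin (D.b i)

/-- The parameter space `ℝ^p`, with its Euclidean norm. -/
abbrev Param : Type := EuclideanSpace ℝ D.Coef

/-- The number `p = ∑ i, b_i` of parameters. -/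
def p : ℕ := ∑ i, D.b i

/-- The set `W × {1, …, M}`. -/
def window : Set (MarkedPoint d M) := D.W ×ˢ (Set.univ : Set (Fin M))

/-- The log-linear intensity `ρ((x, i); β) = d(x) exp(β_iᵀ z_i(x))`. -/
def rho (β : D.Param) (y : MarkedPoint d M) : ℝ :=
  D.base y.1 * Real.exp (∑ j : Fin (D.b y.2), β ⟨y.2, j⟩ * D.z ⟨y.2, j⟩ y.1)

/-- The vector `z(x) = (z_l(x))_{l = 1, …, p}` of all covariates. -/
def zVec (x : Space d) : D.Param := WithLp.toLp 2 fun l => D.z l x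

/-- The Poisson composite log-likelihood
`ℓ(β) = ∑_{y ∈ Y, y ∈ W × {1, …, M}} log ρ(y; β) - ∫_{W × {1, …, M}} ρ(y; β) dy`
of the point pattern `Y`. -/
def loglik (Y : Set (MarkedPoint d M)) (β : D.Param) : ℝ :=
  (∑ᶠ y ∈ Y ∩ D.window, Real.log (D.rho β y))
    - ∫ y in D.window, D.rho β y ∂(refMeasure d M)

/-- The quadratic form `φᵀ {- ℓ⁽²⁾(β)} φ` of the negative Hessian of `ℓ`. -/
def negHessianForm (Y : Set (MarkedPoint d M)) (β φ : D.Param) : ℝ :=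
  - (fderiv ℝ (fderiv ℝ (D.loglik Y)) β φ φ)

/-- The Euclidean norm `‖β^g‖` of the subvector of the coefficients in group `g`. -/
def groupNorm (β : D.Param) (g : Fin D.G) : ℝ :=
  Real.sqrt (∑ l : D.Coef with D.grp l = g, (β l) ^ 2)

/-- The criterion
`Q(β) = μ⁻¹ ℓ(β) - ∑_g λ^g ‖β^g‖ - ∑_l λ_l |β_l|` (sparse group lasso). -/
def objective (μ : ℝ) (lamG : Fin D.G → ℝ≥0) (lamL : D.Coef → ℝ≥0)
    (Y : Set (MarkedPoint d M)) (β : D.Param) : ℝ :=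
  μ⁻¹ * D.loglik Y β - ∑ g, (lamG g : ℝ) * D.groupNorm β g - ∑ l, (lamL l : ℝ) * |β l|

open Classical in
/-- `I_0`, the set of the coefficients that vanish in the parameter `β`. -/
def inactive (β : D.Param) : Finset D.Coef := {l | β l = 0}

open Classical in
/-- `I_1`, the set of the coefficients that do not vanish in the parameter `β`. -/
def active (β : D.Param) : Finset D.Coef := {l | β l ≠ 0}

open Classical in
/-- `Γ_1`, the set of the groups that contain an active coefficient of `β`. -/
def activeGroups (β : D.Param) : Finset (Fin D.G) := {g | ∃ l ∈ D.active β, D.grp l = g}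

/-- The cardinality `γ_g` of group `g`. -/
def groupCard (g : Fin D.G) : ℕ := (Finset.univ.filter fun l : D.Coef => D.grp l = g).card

end Design

/-- `μ`, the expected number of observed points. -/
def meanPoints {d M : ℕ} {Ω : Type*} [MeasurableSpace Ω] (P : Measure Ω) (D : Design d M)
    (Y : Ω → Set (MarkedPoint d M)) : ℝ :=
  (expectedCount P Y D.window).toReal

/-! ### Stochastic orders, for random variables on probability spaces indexed by `n` -/

/-- `X_n = O_P(r_n)`. -/
def IsBigOP {Ω : ℕ → Type*} [∀ n, MeasurableSpace (Ω n)] (P : ∀ n, Measure (Ω n))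
    (X : ∀ n, Ω n → ℝ) (r : ℕ → ℝ) : Prop :=
  ∀ ε : ℝ, 0 < ε → ∃ K : ℝ, ∀ᶠ n in atTop, P n {ω | K * r n < |X n ω|} ≤ ENNReal.ofReal ε

/-- `X_n = o_P(1)`, for random variables with values in `[0, ∞]`. -/
def IsLittleOPOne {Ω : ℕ → Type*} [∀ n, MeasurableSpace (Ω n)] (P : ∀ n, Measure (Ω n))
    (X : ∀ n, Ω n → ℝ≥0∞) : Prop :=
  ∀ ε : ℝ≥0∞, 0 < ε → Tendsto (fun n => P n {ω | ε ≤ X n ω}) atTop (𝓝 0)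

/-! ### The conditions -/

/-- The conditions on the sequence of models: the mean number of points `μ_n`, the dimension
`p_n`, the baseline and the covariates, the second-order structure and the likelihood. -/
structure RegularityConditions {d M : ℕ} {Ω : ℕ → Type*} [∀ n, MeasurableSpace (Ω n)]
    (P : ∀ n, Measure (Ω n)) (D : ℕ → Design d M) (βstar : ∀ n, (D n).Param)
    (Y : ∀ n, Ω n → Set (MarkedPoint d M))
    (g : ℕ → MarkedPoint d M → MarkedPoint d M → ℝ) : Prop where
  mean_tendsto : Tendsto (fun n => meanPoints (P n) (D n) (Y n)) atTop atTop
  dim_tendsto : Tendsto (fun n => ((D n).p : ℝ) ^ 4 / meanPoints (P n) (D n) (Y n)) atTop (𝓝 0)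
  base_bounded : ∀ n, ∃ C : ℝ, ∀ x, |(D n).base x| ≤ C
  z_bounded : ∃ C : ℝ, ∀ n l x, |(D n).z l x| ≤ C
  /-- `∫∫ ρ(y; β) ρ(y'; β) |g(y, y') - 1| dy dy' = O(μ)` for all `β` in `√(p/μ)`-neighbourhoods
  of the true parameter. -/
  pair_correlation : ∀ β : ∀ n, (D n).Param,
    (fun n => ‖β n - βstar n‖) =O[atTop]
      (fun n => Real.sqrt ((D n).p / meanPoints (P n) (D n) (Y n))) →
    ∃ C : ℝ, ∀ᶠ n in atTop,
      ∫⁻ y in (D n).window, ∫⁻ y' in (D n).window,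
          ENNReal.ofReal ((D n).rho (β n) y * (D n).rho (β n) y' * |g n y y' - 1|)
          ∂(refMeasure d M) ∂(refMeasure d M)
        ≤ ENNReal.ofReal (C * meanPoints (P n) (D n) (Y n))
  /-- `inf_n inf_{‖φ‖ = 1} μ⁻¹ φᵀ {- ℓ⁽²⁾(β⋆)} φ > 0`; the Hessian of `ℓ` does not depend on the
  point pattern. -/
  sensitivity : ∃ α : ℝ, 0 < α ∧ ∀ n (ω : Ω n) (φ : (D n).Param), ‖φ‖ = 1 →
    α ≤ (meanPoints (P n) (D n) (Y n))⁻¹ * (D n).negHessianForm (Y n ω) (βstar n) φ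
  /-- `∑_i ∫_W ‖z(x)‖^q ρ((x, i); β) dx = O(p^{q/2} μ)`, `q = 1, 3`, for all `β` in
  `√(p/μ)`-neighbourhoods of the true parameter. -/
  moments : ∀ β : ∀ n, (D n).Param,
    (fun n => ‖β n - βstar n‖) =O[atTop]
      (fun n => Real.sqrt ((D n).p / meanPoints (P n) (D n) (Y n))) →
    ∀ q ∈ ({1, 3} : Set ℕ), ∃ C : ℝ, ∀ᶠ n in atTop,
      ∑ i : Fin M, ∫⁻ x in (D n).W,
          ENNReal.ofReal (‖(D n).zVec x‖ ^ q * (D n).rho (β n) (x, i))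
        ≤ ENNReal.ofReal
            (C * (((D n).p : ℝ) ^ ((q : ℝ) / 2) * meanPoints (P n) (D n) (Y n)))

/-- The conditions on the (possibly random) regularization parameters `λ^g` and `λ_l`. -/
structure PenaltyConditions {d M : ℕ} {Ω : ℕ → Type*} [∀ n, MeasurableSpace (Ω n)]
    (P : ∀ n, Measure (Ω n)) (D : ℕ → Design d M) (βstar : ∀ n, (D n).Param)
    (Y : ∀ n, Ω n → Set (MarkedPoint d M))
    (lamG : ∀ n, Ω n → Fin (D n).G → ℝ≥0) (lamL : ∀ n, Ω n → (D n).Coef → ℝ≥0) : Prop where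
  /-- `(max_{l ∈ I_1} λ_l) √(i_1 μ / p) = o_P(1)`. -/
  coef_active : IsLittleOPOne P fun n ω =>
    (((D n).active (βstar n)).sup (lamL n ω) : ℝ≥0) *
      ENNReal.ofReal (Real.sqrt
        (((D n).active (βstar n)).card * meanPoints (P n) (D n) (Y n) / (D n).p))
  /-- `(max_{g ∈ Γ_1} λ^g) √((∑_{g ∈ Γ_1} γ_g) μ / p) = o_P(1)`. -/
  group_active : IsLittleOPOne P fun n ω =>
    (((D n).activeGroups (βstar n)).sup (lamG n ω) : ℝ≥0) *
      ENNReal.ofReal (Real.sqrt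
        ((∑ g ∈ (D n).activeGroups (βstar n), ((D n).groupCard g : ℝ)) *
          meanPoints (P n) (D n) (Y n) / (D n).p))
  /-- `(1 / inf_{l ∈ I_0} λ_l) √(p² / μ) = o_P(1)`, with `1 / 0 = ∞` and `inf ∅ = ∞`. -/
  coef_inactive : IsLittleOPOne P fun n ω =>
    (((D n).inactive (βstar n)).inf fun l => (lamL n ω l : ℝ≥0∞))⁻¹ *
      ENNReal.ofReal (Real.sqrt (((D n).p : ℝ) ^ 2 / meanPoints (P n) (D n) (Y n)))

end SparseGroupLassoPP

end

/-!
Write `ν` for the intensity measure of the observed process at the true parameter `β⋆`; its total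
mass is `μ`. With `Z(y)` the covariate vector of a marked point, put into the block of its mark,
the Poisson log-likelihood is the concave exponential family
`ℓ(β) = c + ⟪β, ∑_y Z(y)⟫ - ∫ exp ⟪β - β⋆, Z⟫ dν` (`Design.loglik_eq_canonicalLoglik`), with score
`U = ∑_y Z(y) - ∫ Z dν` at `β⋆` and negative Hessian `φ ↦ ∫ ⟪φ, Z⟫² dν` there.

*Size of the score.* Integrating against the first two moment measures of the process bounds the
variance of `∑_y f(y)` by `‖f‖_∞² (μ + ∫∫ |g - 1| dν dν)` (`integral_sq_sum_sub_le`). Summed over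
the `p` coordinates, this is `E ‖U‖² = O(p μ)`, so `‖U‖ ≤ B √(p μ)` with high probability
(`measure_norm_score_gt_le`).

*Consistency.* On the sphere `‖u‖ = K √(p/μ)` the exponents `⟪u, Z⟫` are uniformly small, because
`‖Z‖ = O(√p)` and `p² / μ → 0`; hence
`ℓ(β⋆ + u) - ℓ(β⋆) ≤ ⟪u, U⟫ - ¼ ∫ ⟪u, Z⟫² dν ≤ K B p - ¼ α K² p`. Only active coefficients and
groups can let the penalty decrease, and by at most `2 K p / μ`. For large `K` the objective is
thus smaller on the sphere than at its centre (`objective_lt_on_sphere`), and by concavity a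
maximizer exists and all maximizers are inside (`exists_isMaxOn_and_norm_lt_of_sphere`).

*Sparsity.* Within the sphere every component of the gradient of `ℓ / μ` is `O(√(p²/μ))`, which is
less than every `λ_l` with `l` inactive. If such a coordinate of a maximizer did not vanish,
setting it to zero would increase the objective (`apply_eq_zero_of_isMaxOn`).
-/

namespace SparseGroupLassoPP

/-! ### Second-moment bound for sums over a point process -/

section Campbell

variable {α Ω : Type*} [MeasurableSpace α] [MeasurableSpace Ω]

/-- The counting measure `∑_{y ∈ s} δ_y` of a finite point configuration. -/
noncomputable def pointMeasure (s : Finset α) : Measure α := ∑ y ∈ s, Measure.dirac y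

instance (s : Finset α) : IsFiniteMeasure (pointMeasure s) := by
  unfold pointMeasure; infer_instance

theorem pointMeasure_apply (s : Finset α) {A : Set α} (hA : MeasurableSet A) :
    pointMeasure s A = (((s : Set α) ∩ A).encard : ℕ∞) := by
  classical
  have h : ((s : Set α) ∩ A) = ((s.filter (· ∈ A) : Finset α) : Set α) := by
    ext; simp
  rw [h, Set.encard_coe_eq_coe_finsetCard]
  simp [pointMeasure, Measure.finsetSum_apply, Measure.dirac_apply' _ hA, Set.indicator_apply]

theorem integral_pointMeasure [MeasurableSingletonClass α] {E : Type*} [NormedAddCommGroup E]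
    [NormedSpace ℝ E] [CompleteSpace E] (s : Finset α) (f : α → E) :
    ∫ y, f y ∂(pointMeasure s) = ∑ y ∈ s, f y := by
  unfold pointMeasure
  rw [integral_finsetSum_measure]
  · simp
  · intro i _
    exact integrable_dirac (by simp)

/-- Ordered pairs of points are pairs of distinct points or points counted twice. -/
theorem pointMeasure_mul (s : Finset α) {A B : Set α} (hA : MeasurableSet A)
    (hB : MeasurableSet B) :
    pointMeasure s A * pointMeasure s B
      = ((((s : Set α).offDiag ∩ A ×ˢ B).encard : ℕ∞) : ℝ≥0∞) + pointMeasure s (A ∩ B) := by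
  classical
  rw [pointMeasure_apply s hA, pointMeasure_apply s hB, pointMeasure_apply s (hA.inter hB),
    ← ENat.toENNReal_mul, ← ENat.toENNReal_add]
  congr 1
  have hprod : ((s : Set α) ∩ A).encard * ((s : Set α) ∩ B).encard
      = (((s : Set α) ∩ A) ×ˢ ((s : Set α) ∩ B)).encard := by
    rw [Set.encard_prod]
  have hdiag : ((s : Set α) ∩ (A ∩ B)).encard
      = ((fun y => (y, y)) '' ((s : Set α) ∩ (A ∩ B))).encard := by
    rw [Function.Injective.encard_image]
    intro a b h
    exact (Prod.ext_iff.1 h).1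
  rw [hprod, hdiag, ← Set.encard_union_eq]
  · congr 1
    ext ⟨a, b⟩
    simp only [Set.mem_prod, Set.mem_inter_iff, Set.mem_union, Set.mem_offDiag, Set.mem_image,
      Prod.mk.injEq]
    constructor
    · rintro ⟨⟨ha, hA⟩, hb, hB⟩
      by_cases h : a = b
      · subst h
        exact Or.inr ⟨a, ⟨ha, hA, hB⟩, rfl, rfl⟩
      · exact Or.inl ⟨⟨ha, hb, h⟩, hA, hB⟩
    · rintro (⟨⟨ha, hb, _⟩, hA, hB⟩ | ⟨c, ⟨hc, hA, hB⟩, rfl, rfl⟩)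
      · exact ⟨⟨ha, hA⟩, hb, hB⟩
      · exact ⟨⟨hc, hA⟩, hc, hB⟩
  · rw [Set.disjoint_left]
    rintro ⟨a, b⟩ h
    simp only [Set.mem_inter_iff, Set.mem_offDiag, Set.mem_image, Prod.mk.injEq, not_exists,
      not_and] at h ⊢
    rintro c _ rfl hcb
    exact h.1.2.2 hcb

/-- **Variance bound.** For a finite random configuration with intensity measure `ν` and pair
correlation function `g` relative to `ν`, the centred sum of a function bounded by `C` has second
moment at most `C² (ν(α) + ∫∫ |g - 1| dν dν)`. -/
theorem integral_sq_sum_sub_le [MeasurableSingletonClass α] (P : Measure Ω)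
    [IsProbabilityMeasure P] (s : Ω → Finset α) (ν : Measure α) [IsFiniteMeasure ν]
    (g : α → α → ℝ) (hgm : Measurable (Function.uncurry g)) (hg0 : ∀ y y', 0 ≤ g y y')
    (hmeas : ∀ A, MeasurableSet A → Measurable fun ω => pointMeasure (s ω) A)
    (hfirst : ∀ A, MeasurableSet A → ∫⁻ ω, pointMeasure (s ω) A ∂P = ν A)
    (hsecond : ∀ A B, MeasurableSet A → MeasurableSet B →
      ∫⁻ ω, ((((s ω : Set α).offDiag ∩ A ×ˢ B).encard : ℕ∞) : ℝ≥0∞) ∂P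
        = ∫⁻ y in A, ∫⁻ y' in B, ENNReal.ofReal (g y y') ∂ν ∂ν)
    {V : ℝ} (hV0 : 0 ≤ V)
    (hV : ∫⁻ y, ∫⁻ y', ENNReal.ofReal |g y y' - 1| ∂ν ∂ν ≤ ENNReal.ofReal V)
    (f : α → ℝ) (hf : Measurable f) {C : ℝ} (hC : ∀ y, |f y| ≤ C) :
    Integrable (fun ω => (∑ y ∈ s ω, f y - ∫ y, f y ∂ν) ^ 2) P ∧
      ∫ ω, (∑ y ∈ s ω, f y - ∫ y, f y ∂ν) ^ 2 ∂P ≤ C ^ 2 * (ν.real Set.univ + V) := by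
  have hκm : Measurable fun ω => pointMeasure (s ω) := Measure.measurable_of_measurable_coe _ hmeas
  let κ : ProbabilityTheory.Kernel Ω α := ⟨fun ω => pointMeasure (s ω), hκm⟩
  have hκ2m : Measurable fun ω => (pointMeasure (s ω)).prod (pointMeasure (s ω)) := by
    refine Measurable.measure_of_isPiSystem generateFrom_prod.symm isPiSystem_prod ?_ ?_
    · rintro _ ⟨A, hA, B, hB, rfl⟩
      simp only [Measure.prod_prod]
      exact (hmeas A hA).mul (hmeas B hB)
    · simp only [← Set.univ_prod_univ, Measure.prod_prod]
      exact (hmeas _ .univ).mul (hmeas _ .univ)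
  let κ2 : ProbabilityTheory.Kernel Ω (α × α) :=
    ⟨fun ω => (pointMeasure (s ω)).prod (pointMeasure (s ω)), hκ2m⟩
  let c : ProbabilityTheory.Kernel Unit Ω := ProbabilityTheory.Kernel.const Unit P
  -- first moment measure
  have h1 : (κ.comp c) () = ν := by
    ext A hA
    rw [ProbabilityTheory.Kernel.comp_apply' _ _ _ hA]
    exact hfirst A hA
  have hgm' : Measurable fun q : α × α => ENNReal.ofReal (g q.1 q.2) :=
    ENNReal.measurable_ofReal.comp hgm
  have habs : Measurable fun q : α × α => |g q.1 q.2 - 1| := by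
    have : Measurable fun q : α × α => g q.1 q.2 := hgm
    fun_prop
  have hVprod : ∫⁻ q, ENNReal.ofReal |g q.1 q.2 - 1| ∂(ν.prod ν) ≤ ENNReal.ofReal V := by
    have hm : Measurable fun q : α × α => ENNReal.ofReal |g q.1 q.2 - 1| :=
      ENNReal.measurable_ofReal.comp habs
    rw [lintegral_prod _ hm.aemeasurable]
    exact hV
  have habs_int : Integrable (fun q : α × α => |g q.1 q.2 - 1|) (ν.prod ν) := by
    refine ⟨habs.aestronglyMeasurable, ?_⟩
    rw [hasFiniteIntegral_iff_ofReal (Eventually.of_forall fun _ => abs_nonneg _)]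
    exact hVprod.trans_lt ENNReal.ofReal_lt_top
  have hg1_int : Integrable (fun q : α × α => g q.1 q.2 - 1) (ν.prod ν) := by
    refine habs_int.mono' ?_ (Eventually.of_forall fun q => le_of_eq (Real.norm_eq_abs _))
    have : Measurable fun q : α × α => g q.1 q.2 := hgm
    exact (this.sub measurable_const).aestronglyMeasurable
  have hg_int : Integrable (fun q : α × α => g q.1 q.2) (ν.prod ν) := by
    refine (hg1_int.add (integrable_const (1 : ℝ))).congr (Eventually.of_forall fun q => ?_)
    simp
  have hfin : IsFiniteMeasure ((ν.prod ν).withDensity fun q => ENNReal.ofReal (g q.1 q.2)) := by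
    refine isFiniteMeasure_withDensity ?_
    exact ((hasFiniteIntegral_iff_ofReal (Eventually.of_forall fun q : α × α => hg0 q.1 q.2)).1 hg_int.2).ne
  have hdiag : Measurable fun y : α => (y, y) := by fun_prop
  -- second moment measure
  have h2 : (κ2.comp c) () = ν.map (fun y => (y, y))
      + (ν.prod ν).withDensity fun q => ENNReal.ofReal (g q.1 q.2) := by
    symm
    refine Measure.ext_prod fun {A B} hA hB => ?_
    rw [ProbabilityTheory.Kernel.comp_apply' _ _ _ (hA.prod hB), Measure.add_apply,
      Measure.map_apply hdiag (hA.prod hB), withDensity_apply _ (hA.prod hB)]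
    have hpre : (fun y : α => (y, y)) ⁻¹' A ×ˢ B = A ∩ B := by ext; simp
    rw [hpre, setLIntegral_prod _ hgm'.aemeasurable, ← hsecond A B hA hB,
      ← hfirst _ (hA.inter hB)]
    have : ∀ ω, κ2 ω (A ×ˢ B) = ((((s ω : Set α).offDiag ∩ A ×ˢ B).encard : ℕ∞) : ℝ≥0∞)
        + pointMeasure (s ω) (A ∩ B) := fun ω => by
      rw [← pointMeasure_mul (s ω) hA hB]
      exact Measure.prod_prod _ _
    simp only [this]
    rw [lintegral_add_right _ (hmeas _ (hA.inter hB)), add_comm]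
    rfl
  have hfi : ∀ (η : Measure α) [IsFiniteMeasure η], Integrable f η := fun η _ =>
    Integrable.of_bound hf.aestronglyMeasurable C (Eventually.of_forall hC)
  have hffm : Measurable fun q : α × α => f q.1 * f q.2 := by fun_prop
  have hC0 : ∀ y : α, 0 ≤ C := fun y => (abs_nonneg _).trans (hC y)
  have hffb : ∀ q : α × α, |f q.1 * f q.2| ≤ C ^ 2 := fun q => by
    rw [abs_mul, sq]
    exact mul_le_mul (hC _) (hC _) (abs_nonneg _) (hC0 q.1)
  have hffi : ∀ (η : Measure (α × α)) [IsFiniteMeasure η],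
      Integrable (fun q : α × α => f q.1 * f q.2) η := fun η _ =>
    Integrable.of_bound hffm.aestronglyMeasurable (C ^ 2) (Eventually.of_forall hffb)
  set m := ∫ y, f y ∂ν with hm
  have hX1 : ∀ ω, ∫ y, f y ∂(κ ω) = ∑ y ∈ s ω, f y := fun ω => integral_pointMeasure (s ω) f
  have hX2 : ∀ ω, ∫ q, f q.1 * f q.2 ∂(κ2 ω) = (∑ y ∈ s ω, f y) ^ 2 := fun ω => by
    have : ∫ q, f q.1 * f q.2 ∂(κ2 ω)
        = (∫ y, f y ∂(pointMeasure (s ω))) * ∫ y, f y ∂(pointMeasure (s ω)) :=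
      integral_prod_mul f f
    rw [this, integral_pointMeasure, sq]
  have hi1 : Integrable f ((κ.comp c) ()) := by rw [h1]; exact hfi ν
  have hi2 : Integrable (fun q : α × α => f q.1 * f q.2) ((κ2.comp c) ()) := by
    rw [h2]; exact hffi _
  have e1 : ∫ ω, ∑ y ∈ s ω, f y ∂P = m := by
    have := ProbabilityTheory.Kernel.integral_comp hi1
    rw [h1] at this
    simp only [hX1] at this
    exact this.symm
  have i1 : Integrable (fun ω => ∑ y ∈ s ω, f y) P := by
    have := hi1.integral_comp
    simp only [hX1] at this
    exact this
  have e2 : ∫ ω, (∑ y ∈ s ω, f y) ^ 2 ∂P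
      = ∫ y, f y ^ 2 ∂ν + ∫ q, g q.1 q.2 * (f q.1 * f q.2) ∂(ν.prod ν) := by
    have := ProbabilityTheory.Kernel.integral_comp hi2
    simp only [hX2] at this
    refine this.symm.trans ?_
    rw [h2, integral_add_measure (hffi _) (hffi _), integral_map hdiag.aemeasurable
      hffm.aestronglyMeasurable, integral_withDensity_eq_integral_toReal_smul hgm'
      (Eventually.of_forall fun _ => ENNReal.ofReal_lt_top)]
    congr 1
    · simp only [sq]
    · simp only [ENNReal.toReal_ofReal (hg0 _ _), smul_eq_mul]
  have i2 : Integrable (fun ω => (∑ y ∈ s ω, f y) ^ 2) P := by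
    have := hi2.integral_comp
    simp only [hX2] at this
    exact this
  have expand : ∀ ω, (∑ y ∈ s ω, f y - m) ^ 2
      = (∑ y ∈ s ω, f y) ^ 2 - 2 * m * ∑ y ∈ s ω, f y + m ^ 2 := fun ω => by ring
  simp only [expand]
  have i12 : Integrable (fun ω => (∑ y ∈ s ω, f y) ^ 2 - 2 * m * ∑ y ∈ s ω, f y) P :=
    i2.sub (i1.const_mul _)
  refine ⟨i12.add (integrable_const _), ?_⟩
  rw [integral_add i12 (integrable_const _),
    integral_sub i2 (i1.const_mul _), integral_const_mul, e1, e2]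
  have hmm : m ^ 2 = ∫ q, f q.1 * f q.2 ∂(ν.prod ν) := by
    rw [integral_prod_mul f f, sq]
  have hgff : Integrable (fun q : α × α => (g q.1 q.2 - 1) * (f q.1 * f q.2)) (ν.prod ν) :=
    hg1_int.mul_bdd (c := C ^ 2) hffm.aestronglyMeasurable (Eventually.of_forall hffb)
  have hsplit : ∫ q, g q.1 q.2 * (f q.1 * f q.2) ∂(ν.prod ν)
      = ∫ q, (g q.1 q.2 - 1) * (f q.1 * f q.2) ∂(ν.prod ν) + m ^ 2 := by
    rw [hmm, ← integral_add hgff (hffi _)]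
    congr 1
    ext q
    ring
  have hb1 : ∫ y, f y ^ 2 ∂ν ≤ C ^ 2 * ν.real Set.univ := by
    have : ∫ y, f y ^ 2 ∂ν ≤ ∫ _, C ^ 2 ∂ν := by
      refine integral_mono ?_ (integrable_const _) fun y => ?_
      · refine Integrable.of_bound (hf.pow_const 2).aestronglyMeasurable (C ^ 2)
          (Eventually.of_forall fun y => ?_)
        rw [Real.norm_eq_abs, abs_pow]
        exact pow_le_pow_left₀ (abs_nonneg _) (hC y) 2
      · show f y ^ 2 ≤ C ^ 2
        rw [← sq_abs]
        exact pow_le_pow_left₀ (abs_nonneg _) (hC y) 2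
    refine this.trans (le_of_eq ?_)
    rw [integral_const, smul_eq_mul, mul_comm]
  have hVint : ∫ q, |g q.1 q.2 - 1| ∂(ν.prod ν) ≤ V := by
    rw [integral_eq_lintegral_of_nonneg_ae (Eventually.of_forall fun _ => abs_nonneg _)
      habs.aestronglyMeasurable]
    exact ENNReal.toReal_le_of_le_ofReal hV0 hVprod
  have hb2 : ∫ q, (g q.1 q.2 - 1) * (f q.1 * f q.2) ∂(ν.prod ν) ≤ C ^ 2 * V := by
    calc ∫ q, (g q.1 q.2 - 1) * (f q.1 * f q.2) ∂(ν.prod ν)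
        ≤ ∫ q, C ^ 2 * |g q.1 q.2 - 1| ∂(ν.prod ν) := by
          refine integral_mono hgff (habs_int.const_mul _) fun q => ?_
          refine (le_abs_self _).trans ?_
          show |(g q.1 q.2 - 1) * (f q.1 * f q.2)| ≤ C ^ 2 * |g q.1 q.2 - 1|
          rw [abs_mul, mul_comm]
          exact mul_le_mul_of_nonneg_right (hffb q) (abs_nonneg _)
      _ = C ^ 2 * ∫ q, |g q.1 q.2 - 1| ∂(ν.prod ν) := integral_const_mul _ _
      _ ≤ C ^ 2 * V := mul_le_mul_of_nonneg_left hVint (sq_nonneg _)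
  rw [hsplit]
  simp only [integral_const, probReal_univ, one_smul]
  nlinarith

end Campbell

/-! ### The Poisson log-likelihood as an exponential family -/

section ExponentialFamily

variable {α E : Type*} [NormedAddCommGroup E] [InnerProductSpace ℝ E]

theorem abs_inner_le_of_norm_le {Z : α → E} {R : ℝ} (hR : ∀ y, ‖Z y‖ ≤ R) (u : E) (y : α) :
    |inner ℝ u (Z y)| ≤ ‖u‖ * R :=
  (abs_real_inner_le_norm _ _).trans (mul_le_mul_of_nonneg_left (hR y) (norm_nonneg _))

theorem exp_inner_le {Z : α → E} {R : ℝ} (hR : ∀ y, ‖Z y‖ ≤ R) (u : E) (y : α) :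
    Real.exp (inner ℝ u (Z y)) ≤ Real.exp (‖u‖ * R) :=
  Real.exp_le_exp.2 ((le_abs_self _).trans (abs_inner_le_of_norm_le hR u y))

variable [MeasurableSpace α] [FiniteDimensional ℝ E] [MeasurableSpace E] [BorelSpace E]

theorem aestronglyMeasurable_innerSL_smulRight {G : Type*} [NormedAddCommGroup G]
    [NormedSpace ℝ G] {ν : Measure α} {Z : α → E} (hZ : Measurable Z) {h : α → G} (hh : AEStronglyMeasurable h ν) :
    AEStronglyMeasurable (fun y => (innerSL ℝ (Z y)).smulRight (h y)) ν := by
  have hcont : Continuous fun q : E × G => (innerSL ℝ q.1).smulRight q.2 :=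
    ((ContinuousLinearMap.smulRightL ℝ E G).comp (innerSL ℝ).toContinuousLinearMap).continuous₂
  exact hcont.comp_aestronglyMeasurable (hZ.aestronglyMeasurable.prodMk hh)

/-- The Poisson log-likelihood of a log-linear model in canonical form: `S` is the sufficient
statistic, `Z` the covariate and `ν` the intensity measure at the parameter `β₀`, so that the
intensity measure at `β` has density `exp ⟪β - β₀, Z⟫` with respect to `ν`. -/
noncomputable def canonicalLoglik (ν : Measure α) (Z : α → E) (β₀ : E) (c : ℝ) (S β : E) : ℝ :=
  c + inner ℝ β S - ∫ y, Real.exp (inner ℝ (β - β₀) (Z y)) ∂ν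

variable {ν : Measure α} [IsFiniteMeasure ν] {Z : α → E} {R : ℝ} {β₀ : E} {c : ℝ} {S : E}

theorem integrable_inner (hZ : Measurable Z) (hR : ∀ y, ‖Z y‖ ≤ R) (u : E) :
    Integrable (fun y => inner ℝ u (Z y)) ν := by
  refine Integrable.of_bound (by fun_prop) (‖u‖ * R) (Eventually.of_forall fun y => ?_)
  exact abs_inner_le_of_norm_le hR u y

theorem integrable_exp_inner (hZ : Measurable Z) (hR : ∀ y, ‖Z y‖ ≤ R) (u : E) :
    Integrable (fun y => Real.exp (inner ℝ u (Z y))) ν := by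
  refine Integrable.of_bound (by fun_prop) (Real.exp (‖u‖ * R)) (Eventually.of_forall fun y => ?_)
  rw [Real.norm_of_nonneg (Real.exp_nonneg _)]
  exact exp_inner_le hR u y

theorem integral_innerSL_smulRight_apply {G : Type*} [NormedAddCommGroup G] [NormedSpace ℝ G]
    (hZ : Measurable Z) (hR : ∀ y, ‖Z y‖ ≤ R) {h : α → G}
    (hh : AEStronglyMeasurable h ν) {H : ℝ} (hH : ∀ y, ‖h y‖ ≤ H) (φ : E) :
    (∫ y, (innerSL ℝ (Z y)).smulRight (h y) ∂ν) φ = ∫ y, inner ℝ φ (Z y) • h y ∂ν := by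
  rw [ContinuousLinearMap.integral_apply]
  · refine integral_congr_ae (Eventually.of_forall fun y => ?_)
    simp [real_inner_comm]
  · refine Integrable.of_bound (aestronglyMeasurable_innerSL_smulRight hZ hh) (R * H)
      (Eventually.of_forall fun y => ?_)
    rw [ContinuousLinearMap.norm_smulRight_apply, innerSL_apply_norm]
    exact mul_le_mul (hR y) (hH y) (norm_nonneg _) ((norm_nonneg _).trans (hR y))

/-- Differentiation under the integral sign for a bounded weight `h`; applied once with `h = 1`
and once with the covector `⟪Z, ·⟫`, it gives the first two derivatives of the log-likelihood. -/
theorem hasFDerivAt_integral_exp_inner_smul {G : Type*} [NormedAddCommGroup G] [NormedSpace ℝ G]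
    (hZ : Measurable Z) (hR : ∀ y, ‖Z y‖ ≤ R) {h : α → G}
    (hh : AEStronglyMeasurable h ν) {H : ℝ} (hH : ∀ y, ‖h y‖ ≤ H) (β : E) :
    HasFDerivAt (fun β => ∫ y, Real.exp (inner ℝ (β - β₀) (Z y)) • h y ∂ν)
      (∫ y, Real.exp (inner ℝ (β - β₀) (Z y)) • (innerSL ℝ (Z y)).smulRight (h y) ∂ν) β := by
  have hexp : ∀ β : E, AEStronglyMeasurable (fun y => Real.exp (inner ℝ (β - β₀) (Z y))) ν :=
    fun β => (integrable_exp_inner hZ hR _).aestronglyMeasurable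
  have hsm := aestronglyMeasurable_innerSL_smulRight hZ hh
  have hbound : ∀ y, ∀ x ∈ Metric.ball β 1,
      ‖Real.exp (inner ℝ (x - β₀) (Z y)) • (innerSL ℝ (Z y)).smulRight (h y)‖
        ≤ Real.exp ((1 + ‖β - β₀‖) * R) * (R * H) := by
    intro y x hx
    have hR0 : 0 ≤ R := (norm_nonneg _).trans (hR y)
    have hx' : ‖x - β₀‖ ≤ 1 + ‖β - β₀‖ := by
      have : x - β₀ = (x - β) + (β - β₀) := by abel
      rw [this]
      refine (norm_add_le _ _).trans (add_le_add_left ?_ _)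
      exact (mem_ball_iff_norm.1 hx).le
    rw [norm_smul, ContinuousLinearMap.norm_smulRight_apply, innerSL_apply_norm,
      Real.norm_of_nonneg (Real.exp_nonneg _)]
    refine mul_le_mul ?_ (mul_le_mul (hR y) (hH y) (norm_nonneg _) hR0) (by positivity)
      (Real.exp_nonneg _)
    exact (exp_inner_le hR _ y).trans
      (Real.exp_le_exp.2 (mul_le_mul_of_nonneg_right hx' hR0))
  refine hasFDerivAt_integral_of_dominated_of_fderiv_le (Metric.ball_mem_nhds β one_pos)
    (Eventually.of_forall fun β => (hexp β).smul hh) ?_ ((hexp β).smul hsm)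
    (Eventually.of_forall hbound) (integrable_const _) (Eventually.of_forall fun y x _ => ?_)
  · exact (integrable_exp_inner hZ hR _).smul_bdd H hh (Eventually.of_forall hH)
  · have h1 : HasFDerivAt (fun x : E => inner ℝ (x - β₀) (Z y)) (innerSL ℝ (Z y)) x := by
      have := (innerSL ℝ (Z y)).hasFDerivAt (x := x - β₀)
      have h2 := this.comp x ((hasFDerivAt_id x).sub_const β₀)
      refine h2.congr_of_eventuallyEq (Eventually.of_forall fun x => ?_)
      simp [real_inner_comm]
    have h3 := h1.exp.smul_const (h y)
    refine h3.congr_fderiv ?_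
    ext v
    simp [smul_smul]

theorem hasFDerivAt_canonicalLoglik (hZ : Measurable Z) (hR : ∀ y, ‖Z y‖ ≤ R) (β : E) :
    HasFDerivAt (canonicalLoglik ν Z β₀ c S)
      (innerSL ℝ S - ∫ y, Real.exp (inner ℝ (β - β₀) (Z y)) • innerSL ℝ (Z y) ∂ν) β := by
  have h := hasFDerivAt_integral_exp_inner_smul (ν := ν) (β₀ := β₀) hZ hR
    (h := fun _ => (1 : ℝ)) aestronglyMeasurable_const (H := 1) (by simp) β
  have h1 : HasFDerivAt (fun β : E => c + inner ℝ β S) (innerSL ℝ S) β := by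
    have := ((innerSL ℝ S).hasFDerivAt (x := β)).const_add c
    refine this.congr_of_eventuallyEq (Eventually.of_forall fun x => ?_)
    simp [real_inner_comm]
  have hone : ∀ y, (innerSL ℝ (Z y)).smulRight (1 : ℝ) = innerSL ℝ (Z y) := fun y => by
    ext v; simp
  simp only [hone, smul_eq_mul, mul_one] at h
  exact h1.sub h

theorem continuous_canonicalLoglik (hZ : Measurable Z) (hR : ∀ y, ‖Z y‖ ≤ R) :
    Continuous (canonicalLoglik ν Z β₀ c S) :=
  continuous_iff_continuousAt.2 fun β => (hasFDerivAt_canonicalLoglik hZ hR β).continuousAt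

/-- The Hessian of the log-likelihood at `β₀` is the negative second-moment form of `Z`. -/
theorem fderiv_fderiv_canonicalLoglik (hZ : Measurable Z) (hR : ∀ y, ‖Z y‖ ≤ R) (φ : E) :
    fderiv ℝ (fderiv ℝ (canonicalLoglik ν Z β₀ c S)) β₀ φ φ
      = - ∫ y, (inner ℝ φ (Z y)) ^ 2 ∂ν := by
  have h1 : fderiv ℝ (canonicalLoglik ν Z β₀ c S)
      = fun β => innerSL ℝ S - ∫ y, Real.exp (inner ℝ (β - β₀) (Z y)) • innerSL ℝ (Z y) ∂ν :=
    funext fun β => (hasFDerivAt_canonicalLoglik hZ hR β).fderiv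
  have hm : AEStronglyMeasurable (fun y => innerSL ℝ (Z y)) ν :=
    (innerSL ℝ (E := E)).continuous.comp_aestronglyMeasurable hZ.aestronglyMeasurable
  have hb : ∀ y, ‖innerSL ℝ (Z y)‖ ≤ R := fun y => by rw [innerSL_apply_norm]; exact hR y
  have h2 := (hasFDerivAt_integral_exp_inner_smul (ν := ν) (β₀ := β₀) hZ hR hm hb β₀).const_sub
    (innerSL ℝ S)
  rw [h1, h2.fderiv]
  simp only [sub_self, inner_zero_left, Real.exp_zero, one_smul]
  have hint : Integrable (fun y => inner ℝ φ (Z y) • innerSL ℝ (Z y)) ν :=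
    (integrable_inner hZ hR φ).smul_bdd R hm (Eventually.of_forall hb)
  rw [neg_apply, neg_apply, integral_innerSL_smulRight_apply hZ hR hm hb,
    ContinuousLinearMap.integral_apply hint]
  congr 1
  refine integral_congr_ae (Eventually.of_forall fun y => ?_)
  simp [sq, real_inner_comm]

theorem concaveOn_canonicalLoglik (hZ : Measurable Z) (hR : ∀ y, ‖Z y‖ ≤ R) :
    ConcaveOn ℝ Set.univ (canonicalLoglik ν Z β₀ c S) := by
  refine ⟨convex_univ, fun x _ y _ a b ha hb hab => ?_⟩
  have hc : ∫ w, Real.exp (inner ℝ (a • x + b • y - β₀) (Z w)) ∂ν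
      ≤ a * ∫ w, Real.exp (inner ℝ (x - β₀) (Z w)) ∂ν
        + b * ∫ w, Real.exp (inner ℝ (y - β₀) (Z w)) ∂ν := by
    rw [← integral_const_mul, ← integral_const_mul,
      ← integral_add ((integrable_exp_inner hZ hR _).const_mul _)
        ((integrable_exp_inner hZ hR _).const_mul _)]
    refine integral_mono (integrable_exp_inner hZ hR _)
      (((integrable_exp_inner hZ hR _).const_mul _).add
        ((integrable_exp_inner hZ hR _).const_mul _)) fun w => ?_
    have hsplit : a • x + b • y - β₀ = a • (x - β₀) + b • (y - β₀) := by
      have : β₀ = (a + b) • β₀ := by rw [hab, one_smul]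
      nth_rewrite 1 [this]
      module
    have := convexOn_exp.2 (Set.mem_univ (inner ℝ (x - β₀) (Z w)))
      (Set.mem_univ (inner ℝ (y - β₀) (Z w))) ha hb hab
    simp only [hsplit, inner_add_left, real_inner_smul_left]
    simpa using this
  simp only [canonicalLoglik, smul_eq_mul, inner_add_left, real_inner_smul_left]
  have : c = a * c + b * c := by rw [← add_mul, hab, one_mul]
  linarith

theorem one_add_add_sq_div_four_le_exp {t : ℝ} (ht : |t| ≤ 1) : 1 + t + t ^ 2 / 4 ≤ Real.exp t := by
  have h1 : 1 + t / 2 ≤ Real.exp (t / 2) := by linarith [Real.add_one_le_exp (t / 2)]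
  have h2 : Real.exp t = Real.exp (t / 2) ^ 2 := by
    rw [← Real.exp_nat_mul]; congr 1; push_cast; ring
  rw [h2]
  have h0 : 0 ≤ 1 + t / 2 := by linarith [(abs_le.1 ht).1]
  calc 1 + t + t ^ 2 / 4 = (1 + t / 2) ^ 2 := by ring
    _ ≤ _ := pow_le_pow_left₀ h0 h1 2

/-- Quadratic upper bound of the log-likelihood near `β₀`, with the score `S - ∫ Z dν` as linear
part. -/
theorem canonicalLoglik_add_sub_le (hZ : Measurable Z) (hR : ∀ y, ‖Z y‖ ≤ R) {u : E}
    (hu : ‖u‖ * R ≤ 1) :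
    canonicalLoglik ν Z β₀ c S (β₀ + u) - canonicalLoglik ν Z β₀ c S β₀
      ≤ inner ℝ u (S - ∫ y, Z y ∂ν) - (∫ y, (inner ℝ u (Z y)) ^ 2 ∂ν) / 4 := by
  have hi := integrable_inner (ν := ν) hZ hR u
  have hi2 : Integrable (fun y => (inner ℝ u (Z y)) ^ 2) ν := by
    refine Integrable.of_bound (by fun_prop) ((‖u‖ * R) ^ 2) (Eventually.of_forall fun y => ?_)
    rw [Real.norm_eq_abs, abs_pow]
    exact pow_le_pow_left₀ (abs_nonneg _) (abs_inner_le_of_norm_le hR u y) 2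
  have hZi : Integrable Z ν :=
    Integrable.of_bound hZ.aestronglyMeasurable R (Eventually.of_forall hR)
  have hle : ∫ y, (1 + inner ℝ u (Z y) + (inner ℝ u (Z y)) ^ 2 / 4) ∂ν
      ≤ ∫ y, Real.exp (inner ℝ u (Z y)) ∂ν :=
    integral_mono (((integrable_const 1).add hi).add (hi2.div_const 4))
      (integrable_exp_inner hZ hR u)
      fun y => one_add_add_sq_div_four_le_exp ((abs_inner_le_of_norm_le hR u y).trans hu)
  have h1i : Integrable (fun y => 1 + inner ℝ u (Z y)) ν := (integrable_const 1).add hi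
  rw [integral_add h1i (hi2.div_const 4), integral_add (integrable_const 1) hi,
    integral_div] at hle
  have hin : ∫ y, inner ℝ u (Z y) ∂ν = inner ℝ u (∫ y, Z y ∂ν) := integral_inner hZi u
  simp only [canonicalLoglik, add_sub_cancel_left, sub_self, inner_zero_left, Real.exp_zero,
    inner_add_left, inner_sub_right]
  linarith

/-- First-order bound of the increment of the log-likelihood from `γ` to `γ + w`: the score at `γ`
is compared with the score at `β₀`. -/
theorem canonicalLoglik_add_sub_le_of_near (hZ : Measurable Z) (hR : ∀ y, ‖Z y‖ ≤ R) {γ w : E}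
    {δ b : ℝ} (hγ : ‖γ - β₀‖ * R ≤ δ) (hδ : δ ≤ 1) (hw : ∀ y, |inner ℝ w (Z y)| ≤ b) :
    canonicalLoglik ν Z β₀ c S (γ + w) - canonicalLoglik ν Z β₀ c S γ
      ≤ inner ℝ w (S - ∫ y, Z y ∂ν) + 2 * δ * b * ν.real Set.univ := by
  have hi := integrable_inner (ν := ν) hZ hR w
  have hZi : Integrable Z ν :=
    Integrable.of_bound hZ.aestronglyMeasurable R (Eventually.of_forall hR)
  have hpt : ∀ y, Real.exp (inner ℝ (γ - β₀) (Z y)) + inner ℝ w (Z y) - 2 * δ * b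
      ≤ Real.exp (inner ℝ (γ + w - β₀) (Z y)) := fun y => by
    have hsplit : γ + w - β₀ = (γ - β₀) + w := by abel
    rw [hsplit, inner_add_left, Real.exp_add]
    set s := inner ℝ (γ - β₀) (Z y)
    set t := inner ℝ w (Z y)
    have hs : |s| ≤ δ := (abs_inner_le_of_norm_le hR _ y).trans hγ
    have h1 : Real.exp s * (1 + t) ≤ Real.exp s * Real.exp t :=
      mul_le_mul_of_nonneg_left (by linarith [Real.add_one_le_exp t]) (Real.exp_nonneg _)
    have h2 : |(Real.exp s - 1) * t| ≤ 2 * δ * b := by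
      rw [abs_mul]
      refine mul_le_mul ?_ (hw y) (abs_nonneg _) (by linarith [abs_nonneg s])
      exact (Real.abs_exp_sub_one_le (hs.trans hδ)).trans (by linarith)
    have h3 := (abs_le.1 h2).1
    nlinarith
  have hex := integrable_exp_inner (ν := ν) hZ hR (γ - β₀)
  have hei : Integrable (fun y => Real.exp (inner ℝ (γ - β₀) (Z y)) + inner ℝ w (Z y)) ν :=
    hex.add hi
  have hle : ∫ y, (Real.exp (inner ℝ (γ - β₀) (Z y)) + inner ℝ w (Z y) - 2 * δ * b) ∂ν
      ≤ ∫ y, Real.exp (inner ℝ (γ + w - β₀) (Z y)) ∂ν :=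
    integral_mono (hei.sub (integrable_const (2 * δ * b)))
      (integrable_exp_inner (ν := ν) hZ hR (γ + w - β₀)) hpt
  rw [integral_sub hei (integrable_const _), integral_add hex hi, integral_const, smul_eq_mul]
    at hle
  have hin : ∫ y, inner ℝ w (Z y) ∂ν = inner ℝ w (∫ y, Z y ∂ν) := integral_inner hZi w
  simp only [canonicalLoglik, inner_add_left, inner_sub_right]
  linarith

end ExponentialFamily

/-! ### The sparse group lasso penalty -/

namespace Design

variable {d M : ℕ} (D : Design d M)

theorem card_coef : Fintype.card D.Coef = D.p := by
  simp [Design.p, Fintype.card_sigma]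

/-- The restriction of a parameter to the coefficients of group `g`, extended by zero. -/
noncomputable def groupPart (g : Fin D.G) : D.Param →ₗ[ℝ] D.Param where
  toFun β := WithLp.toLp 2 fun l => if D.grp l = g then β l else 0
  map_add' x y := by
    ext l
    by_cases h : D.grp l = g <;> simp [h]
  map_smul' a x := by
    ext l
    by_cases h : D.grp l = g <;> simp [h]

theorem groupNorm_eq_norm_groupPart (β : D.Param) (g : Fin D.G) :
    D.groupNorm β g = ‖D.groupPart g β‖ := by
  rw [groupNorm, EuclideanSpace.norm_eq, Finset.sum_filter]
  congr 1
  refine Finset.sum_congr rfl fun l _ => ?_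
  by_cases h : D.grp l = g <;> simp [groupPart, h]

/-- The penalty `∑_g λ^g ‖β^g‖ + ∑_l λ_l |β_l|`. -/
noncomputable def penalty (lamG : Fin D.G → ℝ≥0) (lamL : D.Coef → ℝ≥0) (β : D.Param) : ℝ :=
  ∑ g, (lamG g : ℝ) * D.groupNorm β g + ∑ l, (lamL l : ℝ) * |β l|

variable {D} {lamG : Fin D.G → ℝ≥0} {lamL : D.Coef → ℝ≥0}

theorem objective_eq (μ : ℝ) (Y : Set (MarkedPoint d M)) (β : D.Param) :
    D.objective μ lamG lamL Y β = μ⁻¹ * D.loglik Y β - D.penalty lamG lamL β := by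
  unfold objective penalty
  ring

theorem continuous_penalty : Continuous (D.penalty lamG lamL) := by
  unfold penalty
  simp only [groupNorm_eq_norm_groupPart]
  refine (continuous_finsetSum _ fun g _ => ?_).add (continuous_finsetSum _ fun l _ => ?_)
  · exact continuous_const.mul (D.groupPart g).continuous_of_finiteDimensional.norm
  · fun_prop

theorem convexOn_penalty : ConvexOn ℝ Set.univ (D.penalty lamG lamL) := by
  refine ⟨convex_univ, fun x _ y _ a b ha hb _ => ?_⟩
  simp only [penalty, smul_eq_mul, mul_add, Finset.mul_sum]
  have h1 : ∑ g, (lamG g : ℝ) * D.groupNorm (a • x + b • y) g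
      ≤ ∑ g, a * ((lamG g : ℝ) * D.groupNorm x g) + ∑ g, b * ((lamG g : ℝ) * D.groupNorm y g) := by
    rw [← Finset.sum_add_distrib]
    refine Finset.sum_le_sum fun g _ => ?_
    simp only [groupNorm_eq_norm_groupPart, map_add, map_smul]
    have := norm_add_le (a • D.groupPart g x) (b • D.groupPart g y)
    rw [norm_smul, norm_smul, Real.norm_of_nonneg ha, Real.norm_of_nonneg hb] at this
    have := mul_le_mul_of_nonneg_left this (lamG g).2
    simp only [NNReal.val_eq_coe] at this
    linarith
  have h2 : ∑ l, (lamL l : ℝ) * |(a • x + b • y) l|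
      ≤ ∑ l, a * ((lamL l : ℝ) * |x l|) + ∑ l, b * ((lamL l : ℝ) * |y l|) := by
    rw [← Finset.sum_add_distrib]
    refine Finset.sum_le_sum fun l _ => ?_
    have := abs_add_le (a * x l) (b * y l)
    rw [abs_mul, abs_mul, abs_of_nonneg ha, abs_of_nonneg hb] at this
    have := mul_le_mul_of_nonneg_left this (lamL l).2
    simp only [NNReal.val_eq_coe] at this
    simp only [PiLp.add_apply, PiLp.smul_apply, smul_eq_mul]
    linarith
  linarith

/-- Cauchy–Schwarz for the `ℓ¹` norm over a set of coordinates. -/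
theorem sum_abs_le_sqrt_card_mul_norm {ι : Type*} [Fintype ι] (s : Finset ι)
    (u : EuclideanSpace ℝ ι) : ∑ l ∈ s, |u l| ≤ Real.sqrt s.card * ‖u‖ := by
  have h1 : (∑ l ∈ s, |u l|) ^ 2 ≤ s.card * ∑ l ∈ s, |u l| ^ 2 := sq_sum_le_card_mul_sum_sq
  have h2 : ∑ l ∈ s, |u l| ^ 2 ≤ ‖u‖ ^ 2 := by
    rw [EuclideanSpace.norm_sq_eq]
    exact Finset.sum_le_univ_sum_of_nonneg fun l => sq_nonneg _
  refine abs_le_of_sq_le_sq' ?_ (by positivity) |>.2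
  rw [mul_pow, Real.sq_sqrt (Nat.cast_nonneg _)]
  exact h1.trans (mul_le_mul_of_nonneg_left h2 (Nat.cast_nonneg _))

theorem groupNorm_le_sum_abs (u : D.Param) (g : Fin D.G) :
    D.groupNorm u g ≤ ∑ l with D.grp l = g, |u l| := by
  refine Real.sqrt_le_iff.2 ⟨Finset.sum_nonneg fun _ _ => abs_nonneg _, ?_⟩
  calc ∑ l with D.grp l = g, u l ^ 2 = ∑ l with D.grp l = g, |u l| ^ 2 := by simp
    _ ≤ _ := Finset.sum_sq_le_sq_sum_of_nonneg fun _ _ => abs_nonneg _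

/-- Only active coefficients and active groups can let the penalty decrease away from `β⋆`. -/
theorem penalty_sub_le (βs u : D.Param) :
    D.penalty lamG lamL βs - D.penalty lamG lamL (βs + u)
      ≤ ((((D.activeGroups βs).sup lamG : ℝ≥0) : ℝ)
            * Real.sqrt (∑ g ∈ D.activeGroups βs, (D.groupCard g : ℝ))
          + (((D.active βs).sup lamL : ℝ≥0) : ℝ) * Real.sqrt (D.active βs).card) * ‖u‖ := by
  classical
  set a : ℝ≥0 := (D.activeGroups βs).sup lamG
  set b : ℝ≥0 := (D.active βs).sup lamL
  have hG : ∑ g, (lamG g : ℝ) * (D.groupNorm βs g - D.groupNorm (βs + u) g)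
      ≤ a * (Real.sqrt (∑ g ∈ D.activeGroups βs, (D.groupCard g : ℝ)) * ‖u‖) := by
    have h1 : ∀ g, (lamG g : ℝ) * (D.groupNorm βs g - D.groupNorm (βs + u) g)
        ≤ if g ∈ D.activeGroups βs then a * ∑ l with D.grp l = g, |u l| else 0 := by
      intro g
      split_ifs with hg
      · have hle : (lamG g : ℝ) ≤ a := by exact_mod_cast Finset.le_sup (f := lamG) hg
        have htri : D.groupNorm βs g - D.groupNorm (βs + u) g ≤ ∑ l with D.grp l = g, |u l| := by
          refine le_trans ?_ (groupNorm_le_sum_abs u g)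
          simp only [groupNorm_eq_norm_groupPart, map_add]
          have := norm_sub_le (D.groupPart g βs + D.groupPart g u) (D.groupPart g u)
          rw [add_sub_cancel_right] at this
          linarith
        have hnn : 0 ≤ ∑ l with D.grp l = g, |u l| := Finset.sum_nonneg fun _ _ => abs_nonneg _
        exact (mul_le_mul_of_nonneg_left htri (lamG g).2).trans
          (mul_le_mul_of_nonneg_right hle hnn)
      · have hz : D.groupNorm βs g = 0 := by
          unfold groupNorm
          rw [Finset.sum_eq_zero, Real.sqrt_zero]
          intro l hl
          by_contra hne
          refine hg (Finset.mem_filter.2 ⟨Finset.mem_univ _, l, ?_, (Finset.mem_filter.1 hl).2⟩)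
          exact Finset.mem_filter.2 ⟨Finset.mem_univ _, fun h => hne (by rw [h]; simp)⟩
        rw [hz, zero_sub, mul_neg]
        exact neg_nonpos.2 (mul_nonneg (lamG g).2 (Real.sqrt_nonneg _))
    refine (Finset.sum_le_sum fun g _ => h1 g).trans ?_
    rw [← Finset.sum_filter, ← Finset.mul_sum]
    refine mul_le_mul_of_nonneg_left ?_ a.2
    have hfil : Finset.univ.filter (· ∈ D.activeGroups βs) = D.activeGroups βs := by ext; simp
    rw [hfil]
    set T : Finset D.Coef := Finset.univ.filter fun l => D.grp l ∈ D.activeGroups βs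
    have hmaps : ∀ l ∈ T, D.grp l ∈ D.activeGroups βs := fun l hl => (Finset.mem_filter.1 hl).2
    have hfib : ∀ g ∈ D.activeGroups βs,
        T.filter (fun l => D.grp l = g) = Finset.univ.filter fun l => D.grp l = g := by
      intro g hg
      ext l
      simp only [T, Finset.mem_filter, Finset.mem_univ, true_and, and_iff_right_iff_imp]
      rintro rfl
      exact hg
    have hsum : ∑ g ∈ D.activeGroups βs, ∑ l with D.grp l = g, |u l| = ∑ l ∈ T, |u l| := by
      rw [← Finset.sum_fiberwise_of_maps_to hmaps]
      exact Finset.sum_congr rfl fun g hg => by rw [hfib g hg]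
    have hcard : (T.card : ℝ) = ∑ g ∈ D.activeGroups βs, (D.groupCard g : ℝ) := by
      rw [Finset.card_eq_sum_card_fiberwise hmaps, Nat.cast_sum]
      exact Finset.sum_congr rfl fun g hg => by rw [hfib g hg]; rfl
    rw [hsum, ← hcard]
    exact sum_abs_le_sqrt_card_mul_norm T u
  have hL : ∑ l, (lamL l : ℝ) * (|βs l| - |(βs + u) l|)
      ≤ b * (Real.sqrt (D.active βs).card * ‖u‖) := by
    have h1 : ∀ l, (lamL l : ℝ) * (|βs l| - |(βs + u) l|)
        ≤ if l ∈ D.active βs then b * |u l| else 0 := by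
      intro l
      split_ifs with hl
      · have hle : (lamL l : ℝ) ≤ b := by exact_mod_cast Finset.le_sup (f := lamL) hl
        have htri : |βs l| - |(βs + u) l| ≤ |u l| := by
          have := abs_sub_abs_le_abs_sub (βs l) ((βs + u) l)
          simpa using this
        exact (mul_le_mul_of_nonneg_left htri (lamL l).2).trans
          (mul_le_mul_of_nonneg_right hle (abs_nonneg _))
      · have hz : βs l = 0 := by
          by_contra hne
          exact hl (Finset.mem_filter.2 ⟨Finset.mem_univ _, hne⟩)
        rw [hz, abs_zero, zero_sub, mul_neg]
        exact neg_nonpos.2 (mul_nonneg (lamL l).2 (abs_nonneg _))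
    refine (Finset.sum_le_sum fun l _ => h1 l).trans ?_
    rw [← Finset.sum_filter, ← Finset.mul_sum]
    have hfil : Finset.univ.filter (· ∈ D.active βs) = D.active βs := by ext; simp
    rw [hfil]
    exact mul_le_mul_of_nonneg_left (sum_abs_le_sqrt_card_mul_norm _ u) b.2
  simp only [mul_sub, Finset.sum_sub_distrib] at hG hL
  unfold penalty
  linarith

/-- Removing coordinate `l` from `β` saves at least `λ_l |β_l|` of penalty, since the group norms
do not increase. -/
theorem le_penalty_sub_penalty_removed (β : D.Param) (l : D.Coef) :
    (lamL l : ℝ) * |β l| ≤ D.penalty lamG lamL β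
      - D.penalty lamG lamL (β - EuclideanSpace.single l (β l)) := by
  classical
  set β' := β - EuclideanSpace.single l (β l) with hβ'
  have hl : β' l = 0 := by simp [hβ']
  have hne : ∀ k, k ≠ l → β' k = β k := fun k hk => by simp [hβ', hk]
  have habs : ∀ k, |β' k| ≤ |β k| := fun k => by
    by_cases hk : k = l
    · subst hk; rw [hl]; simp
    · rw [hne k hk]
  have hG : ∑ g, (lamG g : ℝ) * D.groupNorm β' g ≤ ∑ g, (lamG g : ℝ) * D.groupNorm β g := by
    refine Finset.sum_le_sum fun g _ => mul_le_mul_of_nonneg_left ?_ (lamG g).2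
    exact Real.sqrt_le_sqrt (Finset.sum_le_sum fun k _ => sq_le_sq.2 (habs k))
  have hL : ∑ k, (lamL k : ℝ) * |β' k| + (lamL l : ℝ) * |β l| = ∑ k, (lamL k : ℝ) * |β k| := by
    rw [← Finset.add_sum_erase _ _ (Finset.mem_univ l),
      ← Finset.add_sum_erase (a := l) _ (fun k => (lamL k : ℝ) * |β k|) (Finset.mem_univ l), hl]
    have : ∑ k ∈ Finset.univ.erase l, (lamL k : ℝ) * |β' k|
        = ∑ k ∈ Finset.univ.erase l, (lamL k : ℝ) * |β k| :=
      Finset.sum_congr rfl fun k hk => by rw [hne k (Finset.ne_of_mem_erase hk)]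
    rw [this]
    simp
  unfold penalty
  linarith

end Design

/-! ### Localization of the maximizer -/

/-- A continuous concave function that is smaller on a sphere than at its centre has a global
maximizer, and all of its maximizers lie inside the sphere. -/
theorem exists_isMaxOn_and_norm_lt_of_sphere {E : Type*} [NormedAddCommGroup E] [NormedSpace ℝ E]
    [FiniteDimensional ℝ E] {Q : E → ℝ} (hcont : Continuous Q) (hconc : ConcaveOn ℝ Set.univ Q)
    {x₀ : E} {r : ℝ} (hr : 0 < r) (hsph : ∀ u, ‖u‖ = r → Q (x₀ + u) < Q x₀) :
    (∃ x, IsMaxOn Q Set.univ x) ∧ ∀ x, IsMaxOn Q Set.univ x → ‖x - x₀‖ < r := by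
  have hout : ∀ x, r ≤ ‖x - x₀‖ → Q x < Q x₀ := by
    intro x hx
    have hpos : 0 < ‖x - x₀‖ := hr.trans_le hx
    set t := r / ‖x - x₀‖ with ht
    have ht0 : 0 < t := div_pos hr hpos
    have ht1 : t ≤ 1 := (div_le_one hpos).2 hx
    have hu := hsph (t • (x - x₀)) (by
      rw [norm_smul, Real.norm_of_nonneg ht0.le, ht, div_mul_cancel₀ _ hpos.ne'])
    have hc := hconc.2 (Set.mem_univ x₀) (Set.mem_univ x) (sub_nonneg.2 ht1) ht0.le (by ring)
    have hpt : (1 - t) • x₀ + t • x = x₀ + t • (x - x₀) := by module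
    rw [hpt, smul_eq_mul, smul_eq_mul] at hc
    nlinarith
  refine ⟨?_, fun x hx => ?_⟩
  · obtain ⟨x, hx, hmax⟩ := (isCompact_closedBall x₀ r).exists_isMaxOn
      ⟨x₀, Metric.mem_closedBall_self hr.le⟩ hcont.continuousOn
    refine ⟨x, fun y _ => ?_⟩
    by_cases hy : y ∈ Metric.closedBall x₀ r
    · exact hmax hy
    · rw [mem_closedBall_iff_norm, not_le] at hy
      exact (hout y hy.le).le.trans (hmax (Metric.mem_closedBall_self hr.le))
  · by_contra h
    exact absurd (hx (Set.mem_univ x₀)) (not_le.2 (hout x (not_lt.1 h)))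

namespace Design

/-! ### The point process model in canonical form -/

variable {d M : ℕ} (D : Design d M)

open Classical in
/-- The covariate vector of a marked point `(x, i)`: the vector `z_i(x)` in the block of mark `i`,
zero in the other blocks. It is set to zero where the baseline vanishes; there `Real.log` of the
intensity is `0`, so that `log ρ(y; β) = log d(x) + ⟪β, cov y⟫` holds at every marked point. -/
noncomputable def cov (y : MarkedPoint d M) : D.Param :=
  WithLp.toLp 2 fun l => if y.2 = l.1 ∧ D.base y.1 ≠ 0 then D.z l y.1 else 0

/-- The intensity measure of the observed process at the parameter `β`. -/
noncomputable def intensityMeasure (β : D.Param) : Measure (MarkedPoint d M) :=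
  ((refMeasure d M).restrict D.window).withDensity fun y => ENNReal.ofReal (D.rho β y)

theorem measurableSet_window : MeasurableSet D.window := D.measurableSet_W.prod MeasurableSet.univ

theorem measurable_cov : Measurable D.cov := by
  classical
  refine (WithLp.measurable_toLp 2 _).comp (measurable_pi_lambda _ fun l => ?_)
  refine Measurable.ite ?_ ((D.measurable_z l).comp measurable_fst) measurable_const
  refine MeasurableSet.inter ?_ ?_
  · exact measurable_snd (measurableSet_singleton l.1)
  · exact (D.measurable_base.comp measurable_fst) (measurableSet_singleton (0 : ℝ)).compl

theorem inner_cov {y : MarkedPoint d M} (hy : D.base y.1 ≠ 0) (β : D.Param) :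
    inner ℝ β (D.cov y) = ∑ j : Fin (D.b y.2), β ⟨y.2, j⟩ * D.z ⟨y.2, j⟩ y.1 := by
  simp only [PiLp.inner_apply, cov, hy, ne_eq, not_false_eq_true, and_true, Fintype.sum_sigma]
  rw [Finset.sum_eq_single y.2]
  · refine Finset.sum_congr rfl fun j _ => ?_
    simp [mul_comm]
  · intro i _ hi
    refine Finset.sum_eq_zero fun j _ => ?_
    simp [hi.symm]
  · simp

theorem rho_eq (β : D.Param) (y : MarkedPoint d M) :
    D.rho β y = D.base y.1 * Real.exp (inner ℝ β (D.cov y)) := by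
  by_cases hy : D.base y.1 = 0
  · simp [rho, hy]
  · rw [inner_cov D hy, rho]

theorem measurable_rho (β : D.Param) : Measurable (D.rho β) := by
  have h : D.rho β = fun y => D.base y.1 * Real.exp (inner ℝ β (D.cov y)) := funext (D.rho_eq β)
  rw [h]
  have h1 := D.measurable_cov
  have h2 := D.measurable_base
  fun_prop

theorem rho_nonneg (β : D.Param) (y : MarkedPoint d M) : 0 ≤ D.rho β y :=
  mul_nonneg (D.base_nonneg _) (Real.exp_nonneg _)

theorem rho_eq_rho_mul_exp (β β' : D.Param) (y : MarkedPoint d M) :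
    D.rho β y = D.rho β' y * Real.exp (inner ℝ (β - β') (D.cov y)) := by
  rw [rho_eq, rho_eq, mul_assoc, ← Real.exp_add, inner_sub_left]
  congr 2
  ring

theorem log_rho (β : D.Param) (y : MarkedPoint d M) :
    Real.log (D.rho β y) = Real.log (D.base y.1) + inner ℝ β (D.cov y) := by
  classical
  by_cases hy : D.base y.1 = 0
  · have hz : D.cov y = 0 := by ext l; simp [cov, hy]
    rw [rho_eq, hy, hz]
    simp
  · rw [rho_eq, Real.log_mul hy (Real.exp_ne_zero _), Real.log_exp]

theorem abs_cov_apply_le {C : ℝ} (hC0 : 0 ≤ C) (hC : ∀ l x, |D.z l x| ≤ C) (y : MarkedPoint d M)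
    (l : D.Coef) : |D.cov y l| ≤ C := by
  by_cases h : y.2 = l.1 ∧ D.base y.1 ≠ 0
  · simp only [cov, if_pos h]; exact hC l _
  · simp only [cov, if_neg h, abs_zero]; exact hC0

theorem norm_cov_le {C : ℝ} (hC0 : 0 ≤ C) (hC : ∀ l x, |D.z l x| ≤ C) (y : MarkedPoint d M) :
    ‖D.cov y‖ ≤ C * Real.sqrt D.p := by
  rw [EuclideanSpace.norm_eq]
  refine Real.sqrt_le_iff.2 ⟨by positivity, ?_⟩
  rw [mul_pow, Real.sq_sqrt (Nat.cast_nonneg _), ← D.card_coef, mul_comm]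
  calc ∑ l, ‖D.cov y l‖ ^ 2 ≤ ∑ _l : D.Coef, C ^ 2 :=
        Finset.sum_le_sum fun l _ =>
          pow_le_pow_left₀ (norm_nonneg _) (D.abs_cov_apply_le hC0 hC y l) 2
    _ = _ := by simp

/-- Integrals over the window against `dy`, with the intensity as weight, are integrals against
the intensity measure. -/
theorem setLIntegral_intensityMeasure (β : D.Param) {A : Set (MarkedPoint d M)}
    (hA : MeasurableSet A) {F : MarkedPoint d M → ℝ≥0∞} (hF : Measurable F) :
    ∫⁻ y in A, F y ∂(D.intensityMeasure β)
      = ∫⁻ y in A ∩ D.window, ENNReal.ofReal (D.rho β y) * F y ∂(refMeasure d M) := by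
  unfold intensityMeasure
  have hm : Measurable fun y => ENNReal.ofReal (D.rho β y) :=
    ENNReal.measurable_ofReal.comp (D.measurable_rho β)
  rw [restrict_withDensity hA, lintegral_withDensity_eq_lintegral_mul _ hm hF,
    Measure.restrict_restrict hA]
  rfl

theorem setLIntegral_setLIntegral_intensityMeasure (β : D.Param) [SFinite (D.intensityMeasure β)]
    {A B : Set (MarkedPoint d M)} (hA : MeasurableSet A) (hB : MeasurableSet B)
    {h : MarkedPoint d M → MarkedPoint d M → ℝ} (hh : Measurable (Function.uncurry h)) :
    ∫⁻ y in A, ∫⁻ y' in B, ENNReal.ofReal (h y y') ∂(D.intensityMeasure β)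
        ∂(D.intensityMeasure β)
      = ∫⁻ y in A ∩ D.window, ∫⁻ y' in B ∩ D.window,
          ENNReal.ofReal (D.rho β y * D.rho β y' * h y y') ∂(refMeasure d M) ∂(refMeasure d M) := by
  have hm : Measurable (Function.uncurry fun y y' => ENNReal.ofReal (h y y')) :=
    ENNReal.measurable_ofReal.comp hh
  have hinner : Measurable fun y => ∫⁻ y' in B, ENNReal.ofReal (h y y') ∂(D.intensityMeasure β) :=
    hm.lintegral_prod_right'
  rw [D.setLIntegral_intensityMeasure β hA hinner]
  refine lintegral_congr fun y => ?_
  have hmy : Measurable fun y' => ENNReal.ofReal (h y y') := hm.of_uncurry_left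
  rw [D.setLIntegral_intensityMeasure β hB hmy, ← lintegral_const_mul']
  · refine lintegral_congr fun y' => ?_
    rw [ENNReal.ofReal_mul (mul_nonneg (D.rho_nonneg β y) (D.rho_nonneg β y')),
      ENNReal.ofReal_mul (D.rho_nonneg β y), mul_assoc]
  · exact ENNReal.ofReal_ne_top

variable {D}

/-- The log-likelihood of a finite pattern is an exponential family with sufficient statistic
`∑_y cov y`. -/
theorem loglik_eq_canonicalLoglik {Y : Set (MarkedPoint d M)} (hfin : (Y ∩ D.window).Finite)
    (β₀ : D.Param) :
    D.loglik Y = canonicalLoglik (D.intensityMeasure β₀) D.cov β₀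
      (∑ y ∈ hfin.toFinset, Real.log (D.base y.1)) (∑ y ∈ hfin.toFinset, D.cov y) := by
  funext β
  unfold loglik canonicalLoglik
  congr 1
  · rw [finsum_mem_eq_finite_toFinset_sum _ hfin, inner_sum, ← Finset.sum_add_distrib]
    exact Finset.sum_congr rfl fun y _ => D.log_rho β y
  · unfold intensityMeasure
    have hm : Measurable fun y => ENNReal.ofReal (D.rho β₀ y) :=
      ENNReal.measurable_ofReal.comp (D.measurable_rho β₀)
    rw [integral_withDensity_eq_integral_toReal_smul hm
      (Eventually.of_forall fun _ => ENNReal.ofReal_lt_top)]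
    refine integral_congr_ae (Eventually.of_forall fun y => ?_)
    simp only [ENNReal.toReal_ofReal (D.rho_nonneg β₀ y), smul_eq_mul]
    exact D.rho_eq_rho_mul_exp β β₀ y

end Design

section Model

variable {d M : ℕ} {Ω : Type*} [MeasurableSpace Ω] {P : Measure Ω} {D : Design d M}
  {Y : Ω → Set (MarkedPoint d M)} {β₀ : D.Param} {g : MarkedPoint d M → MarkedPoint d M → ℝ}

theorem IsPointProcess.finite_inter_window (hY : IsPointProcess Y) (ω : Ω) :
    (Y ω ∩ D.window).Finite := hY.locallyFinite ω D.W D.isBounded_W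

theorem expectedCount_window (hρ : HasIntensity P Y D.window (D.rho β₀)) :
    expectedCount P Y D.window = D.intensityMeasure β₀ Set.univ := by
  rw [hρ _ subset_rfl D.measurableSet_window]
  simp [Design.intensityMeasure]

theorem isFiniteMeasure_intensityMeasure (hρ : HasIntensity P Y D.window (D.rho β₀))
    (hμ : 0 < meanPoints P D Y) : IsFiniteMeasure (D.intensityMeasure β₀) := by
  refine ⟨?_⟩
  rw [← expectedCount_window hρ]
  exact (ENNReal.toReal_pos_iff.1 hμ).2

theorem real_univ_intensityMeasure (hρ : HasIntensity P Y D.window (D.rho β₀)) :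
    (D.intensityMeasure β₀).real Set.univ = meanPoints P D Y := by
  rw [measureReal_def, ← expectedCount_window hρ, meanPoints]

/-- The score of the Poisson log-likelihood at `β₀`. -/
noncomputable def score (D : Design d M) (hY : IsPointProcess Y) (β₀ : D.Param) (ω : Ω) : D.Param :=
  ∑ y ∈ (hY.finite_inter_window (D := D) ω).toFinset, D.cov y
    - ∫ y, D.cov y ∂(D.intensityMeasure β₀)

/-- **Order of the score.** The squared norm of the score at the true parameter has expectation
`O(p μ)`; hence the tail bound. -/
theorem measure_norm_score_gt_le [IsProbabilityMeasure P] (hY : IsPointProcess Y)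
    (hρ : HasIntensity P Y D.window (D.rho β₀))
    (hg : HasPairCorrelation P Y D.window (D.rho β₀) g) {μ : ℝ} (hμ : 0 < μ)
    (hμdef : μ = meanPoints P D Y) (hp : 0 < D.p) {C V B : ℝ} (hC0 : 0 ≤ C)
    (hC : ∀ l x, |D.z l x| ≤ C) (hV0 : 0 ≤ V) (hB : 0 < B)
    (hV : ∫⁻ y in D.window, ∫⁻ y' in D.window,
      ENNReal.ofReal (D.rho β₀ y * D.rho β₀ y' * |g y y' - 1|) ∂(refMeasure d M) ∂(refMeasure d M)
        ≤ ENNReal.ofReal (V * μ)) :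
    P {ω | B * Real.sqrt (D.p * μ) < ‖score D hY β₀ ω‖}
      ≤ ENNReal.ofReal (C ^ 2 * (1 + V) / B ^ 2) := by
  subst hμdef
  have hfinν := isFiniteMeasure_intensityMeasure hρ hμ
  set ν := D.intensityMeasure β₀ with hν
  set μ := meanPoints P D Y with hμ'
  set s : Ω → Finset (MarkedPoint d M) := fun ω =>
    (hY.finite_inter_window (D := D) ω).toFinset with hs
  have hcoe : ∀ ω, ((s ω : Finset _) : Set (MarkedPoint d M)) = Y ω ∩ D.window := fun ω => by
    simp [hs]
  have hcount : ∀ ω A, MeasurableSet A →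
      pointMeasure (s ω) A = (((Y ω ∩ (A ∩ D.window)).encard : ℕ∞) : ℝ≥0∞) := fun ω A hA => by
    rw [pointMeasure_apply _ hA, hcoe, Set.inter_assoc, Set.inter_comm D.window A]
  have hmW := D.measurableSet_window
  have hpc := fun f hf hfC => integral_sq_sum_sub_le P s ν g hg.measurable hg.nonneg
    (fun A hA => by
      simp only [hcount _ _ hA]
      exact hY.measurable_count _ (hA.inter hmW))
    (fun A hA => by
      simp only [hcount _ _ hA]
      have h1 := hρ (A ∩ D.window) Set.inter_subset_right (hA.inter hmW)
      have h2 := D.setLIntegral_intensityMeasure β₀ hA (F := fun _ => 1) measurable_const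
      simp only [mul_one, lintegral_const, Measure.restrict_apply_univ, one_mul] at h2
      rw [hν, h2]
      exact h1)
    (fun A B hA hB => by
      rw [D.setLIntegral_setLIntegral_intensityMeasure β₀ hA hB hg.measurable,
        ← hg.factorial_moment _ Set.inter_subset_right _ Set.inter_subset_right
          (hA.inter hmW) (hB.inter hmW)]
      refine lintegral_congr fun ω => ?_
      congr 2
      rw [hcoe]
      ext ⟨y, y'⟩
      simp only [Set.mem_inter_iff, Set.mem_offDiag, Set.mem_prod]
      tauto)
    (V := V * μ) (mul_nonneg hV0 hμ.le)
    (by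
      have habs : Measurable (Function.uncurry fun y y' => |g y y' - 1|) := by
        have hgm : Measurable fun q : MarkedPoint d M × MarkedPoint d M => g q.1 q.2 :=
          hg.measurable
        have : Measurable fun q : MarkedPoint d M × MarkedPoint d M => |g q.1 q.2 - 1| := by
          fun_prop
        exact this
      have := D.setLIntegral_setLIntegral_intensityMeasure β₀ .univ .univ habs
      simp only [Measure.restrict_univ, Set.univ_inter] at this
      rw [hν, this]
      exact hV)
    f hf (C := C) hfC
  have hcoord : ∀ l : D.Coef,
      Integrable (fun ω => (score D hY β₀ ω l) ^ 2) P ∧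
        ∫ ω, (score D hY β₀ ω l) ^ 2 ∂P ≤ C ^ 2 * (1 + V) * μ := fun l => by
    have hm : Measurable fun y => D.cov y l :=
      (EuclideanSpace.proj (𝕜 := ℝ) l).continuous.measurable.comp D.measurable_cov
    have h := hpc (fun y => D.cov y l) hm fun y => D.abs_cov_apply_le hC0 hC y l
    have hint : Integrable D.cov ν := Integrable.of_bound D.measurable_cov.aestronglyMeasurable
      (C * Real.sqrt D.p) (Eventually.of_forall (D.norm_cov_le hC0 hC))
    have heq : ∀ ω, score D hY β₀ ω l = ∑ y ∈ s ω, D.cov y l - ∫ y, D.cov y l ∂ν := fun ω => by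
      have h1 : ∫ y, D.cov y l ∂ν = (∫ y, D.cov y ∂ν) l :=
        (EuclideanSpace.proj (𝕜 := ℝ) l).integral_comp_comm hint
      rw [h1]
      simp [score, hs, hν]
    simp only [heq]
    refine ⟨h.1, h.2.trans (le_of_eq ?_)⟩
    rw [hν, real_univ_intensityMeasure hρ]
    ring
  have hnorm : ∀ ω, ‖score D hY β₀ ω‖ ^ 2 = ∑ l, (score D hY β₀ ω l) ^ 2 := fun ω => by
    rw [EuclideanSpace.norm_sq_eq]
    simp
  have hint : Integrable (fun ω => ‖score D hY β₀ ω‖ ^ 2) P := by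
    simp only [hnorm]
    exact integrable_finsetSum _ fun l _ => (hcoord l).1
  have hexp : ∫ ω, ‖score D hY β₀ ω‖ ^ 2 ∂P ≤ D.p * (C ^ 2 * (1 + V) * μ) := by
    simp only [hnorm]
    rw [integral_finsetSum _ fun l _ => (hcoord l).1]
    refine (Finset.sum_le_sum fun l _ => (hcoord l).2).trans (le_of_eq ?_)
    rw [Finset.sum_const, Finset.card_univ, D.card_coef, nsmul_eq_mul]
  have hpr : (0 : ℝ) < D.p := by exact_mod_cast hp
  have hmarkov := mul_meas_ge_le_integral_of_nonneg
    (Eventually.of_forall fun ω => sq_nonneg ‖score D hY β₀ ω‖) hint (B ^ 2 * (D.p * μ))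
  have hsub : {ω | B * Real.sqrt (D.p * μ) < ‖score D hY β₀ ω‖}
      ⊆ {ω | B ^ 2 * (D.p * μ) ≤ ‖score D hY β₀ ω‖ ^ 2} := fun ω hω => by
    have hω' : B * Real.sqrt (D.p * μ) < ‖score D hY β₀ ω‖ := hω
    have h := pow_le_pow_left₀ (by positivity) hω'.le 2
    rwa [mul_pow, Real.sq_sqrt (by positivity)] at h
  refine (measure_mono hsub).trans ?_
  rw [← ofReal_measureReal (measure_ne_top _ _)]
  refine ENNReal.ofReal_le_ofReal ?_
  rw [le_div_iff₀ (by positivity)]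
  have hpm : 0 < D.p * μ := mul_pos hpr hμ
  have := hmarkov.trans hexp
  refine le_of_mul_le_mul_right ?_ hpm
  nlinarith

end Model

/-! ### The deterministic argument on a favourable event -/

section Deterministic

variable {d M : ℕ} {D : Design d M} {ν : Measure (MarkedPoint d M)} [IsFiniteMeasure ν]
  {β₀ S : D.Param} {c C α B K μ : ℝ} {Y : Set (MarkedPoint d M)}
  {lamG : Fin D.G → ℝ≥0} {lamL : D.Coef → ℝ≥0}

/-- On the sphere of radius `K √(p/μ)` about `β₀` the negative quadratic part of the log-likelihood,
of order `K² p`, outweighs the score and the penalty, of order `K p`. -/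
theorem objective_lt_on_sphere (hp : 0 < D.p) (hμ : 0 < μ) (hC0 : 0 ≤ C)
    (hC : ∀ l x, |D.z l x| ≤ C) (hK0 : 0 < K)
    (hℓ : D.loglik Y = canonicalLoglik ν D.cov β₀ c S)
    (hsens : ∀ φ : D.Param, ‖φ‖ = 1 → α * μ ≤ ∫ y, (inner ℝ φ (D.cov y)) ^ 2 ∂ν)
    (hscore : ‖S - ∫ y, D.cov y ∂ν‖ ≤ B * Real.sqrt (D.p * μ))
    (hG : (((D.activeGroups β₀).sup lamG : ℝ≥0) : ℝ) *
      Real.sqrt ((∑ g ∈ D.activeGroups β₀, (D.groupCard g : ℝ)) * μ / D.p) ≤ 1)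
    (hL : (((D.active β₀).sup lamL : ℝ≥0) : ℝ) *
      Real.sqrt ((D.active β₀).card * μ / D.p) ≤ 1)
    (hK : 4 * (B + 2) < α * K) (hsmall : K * C * Real.sqrt ((D.p : ℝ) ^ 2 / μ) ≤ 1)
    {u : D.Param} (hu : ‖u‖ = K * Real.sqrt (D.p / μ)) :
    D.objective μ lamG lamL Y (β₀ + u) < D.objective μ lamG lamL Y β₀ := by
  have hpr : (0 : ℝ) < D.p := by exact_mod_cast hp
  -- all rates are expressed through `t = √(μ/p)`
  set t := Real.sqrt (μ / D.p) with ht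
  have ht0 : 0 < t := Real.sqrt_pos.2 (by positivity)
  have htsq : t ^ 2 = μ / D.p := Real.sq_sqrt (by positivity)
  have hμt : μ = t ^ 2 * D.p := by rw [htsq]; field_simp
  have hr : Real.sqrt (D.p / μ) = t⁻¹ := by rw [ht, ← Real.sqrt_inv, inv_div]
  have hpμ : Real.sqrt (D.p * μ) = t * D.p := by
    rw [hμt, show (D.p : ℝ) * (t ^ 2 * D.p) = (t * D.p) ^ 2 by ring, Real.sqrt_sq (by positivity)]
  have hq : Real.sqrt ((D.p : ℝ) ^ 2 / μ) = Real.sqrt D.p * t⁻¹ := by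
    rw [← hr, ← Real.sqrt_mul (Nat.cast_nonneg _)]
    congr 1
    ring
  rw [mul_div_assoc, Real.sqrt_mul (Finset.sum_nonneg fun g _ => Nat.cast_nonneg _)] at hG
  rw [mul_div_assoc, Real.sqrt_mul (Nat.cast_nonneg _)] at hL
  rw [hr] at hu
  rw [hq] at hsmall
  rw [hpμ] at hscore
  have hupos : 0 < ‖u‖ := by rw [hu]; positivity
  have hR := D.norm_cov_le hC0 hC
  have h1 := canonicalLoglik_add_sub_le (ν := ν) (β₀ := β₀) (c := c) (S := S) D.measurable_cov hR
    (u := u) (by rw [hu]; refine le_trans (le_of_eq ?_) hsmall; ring)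
  rw [← hℓ] at h1
  have hin : inner ℝ u (S - ∫ y, D.cov y ∂ν) ≤ K * B * D.p := by
    refine (real_inner_le_norm _ _).trans ?_
    refine (mul_le_mul_of_nonneg_left hscore (norm_nonneg u)).trans (le_of_eq ?_)
    rw [hu]
    field_simp
  have hquad : α * K ^ 2 * D.p ≤ ∫ y, (inner ℝ u (D.cov y)) ^ 2 ∂ν := by
    have h2 := hsens (‖u‖⁻¹ • u) (by
      rw [norm_smul, norm_inv, norm_norm, inv_mul_cancel₀ hupos.ne'])
    simp only [real_inner_smul_left, mul_pow] at h2
    rw [integral_const_mul] at h2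
    have h3 := mul_le_mul_of_nonneg_left h2 (sq_nonneg ‖u‖)
    rw [← mul_assoc (‖u‖ ^ 2) (‖u‖⁻¹ ^ 2), ← mul_pow, mul_inv_cancel₀ hupos.ne', one_pow,
      one_mul] at h3
    refine le_trans (le_of_eq ?_) h3
    rw [hu, hμt]
    field_simp
  have hpen := Design.penalty_sub_le (lamG := lamG) (lamL := lamL) β₀ u
  have hpen' : D.penalty lamG lamL β₀ - D.penalty lamG lamL (β₀ + u) ≤ 2 * K * (t⁻¹) ^ 2 := by
    refine hpen.trans ?_
    rw [hu]
    have h4 : ((((D.activeGroups β₀).sup lamG : ℝ≥0) : ℝ)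
            * Real.sqrt (∑ g ∈ D.activeGroups β₀, (D.groupCard g : ℝ))
          + (((D.active β₀).sup lamL : ℝ≥0) : ℝ) * Real.sqrt (D.active β₀).card) * t ≤ 2 := by
      linarith
    rw [← le_div_iff₀ ht0] at h4
    refine (mul_le_mul_of_nonneg_right h4 (by positivity)).trans (le_of_eq ?_)
    field_simp
  rw [Design.objective_eq, Design.objective_eq]
  have hdl : D.loglik Y (β₀ + u) - D.loglik Y β₀ ≤ (K * B - α * K ^ 2 / 4) * D.p := by linarith
  have hdl' : μ⁻¹ * (D.loglik Y (β₀ + u) - D.loglik Y β₀)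
      ≤ (K * B - α * K ^ 2 / 4) * (t⁻¹) ^ 2 := by
    refine (mul_le_mul_of_nonneg_left hdl (inv_nonneg.2 hμ.le)).trans (le_of_eq ?_)
    rw [hμt]
    field_simp
  have hneg : (K * B - α * K ^ 2 / 4 + 2 * K) * (t⁻¹) ^ 2 < 0 := by
    refine mul_neg_of_neg_of_pos ?_ (by positivity)
    nlinarith
  linarith

/-- A maximizer within distance `K √(p/μ)` of `β₀` vanishes at an inactive coefficient `l` whose
penalty exceeds `(B + 2 K C²) √(p²/μ)`, a bound of the partial derivatives of `ℓ / μ` within that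
distance: removing the coordinate would increase the objective. -/
theorem apply_eq_zero_of_isMaxOn (hp : 0 < D.p) (hμ : 0 < μ) (hC0 : 0 ≤ C)
    (hC : ∀ l x, |D.z l x| ≤ C) (hB0 : 0 ≤ B)
    (hν : ν.real Set.univ = μ) (hℓ : D.loglik Y = canonicalLoglik ν D.cov β₀ c S)
    (hscore : ‖S - ∫ y, D.cov y ∂ν‖ ≤ B * Real.sqrt (D.p * μ))
    (hsmall : K * C * Real.sqrt ((D.p : ℝ) ^ 2 / μ) ≤ 1) {β : D.Param}
    (hmax : IsMaxOn (D.objective μ lamG lamL Y) Set.univ β)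
    (hβ : ‖β - β₀‖ ≤ K * Real.sqrt (D.p / μ)) {l : D.Coef} (hl : β₀ l = 0)
    (hlam : (B + 2 * K * C ^ 2) * Real.sqrt ((D.p : ℝ) ^ 2 / μ) < lamL l) : β l = 0 := by
  classical
  by_contra hne
  have hpr : (1 : ℝ) ≤ D.p := by exact_mod_cast hp
  set q := Real.sqrt ((D.p : ℝ) ^ 2 / μ) with hq
  have hqpos : 0 < q := Real.sqrt_pos.2 (by positivity)
  have hqsq : q ^ 2 = (D.p : ℝ) ^ 2 / μ := Real.sq_sqrt (by positivity)
  have hR := D.norm_cov_le hC0 hC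
  have hR0 : 0 ≤ C * Real.sqrt D.p := by positivity
  set w : D.Param := EuclideanSpace.single l (β l) with hw
  have hnorm : ‖β - w - β₀‖ ≤ ‖β - β₀‖ := by
    rw [EuclideanSpace.norm_eq, EuclideanSpace.norm_eq]
    refine Real.sqrt_le_sqrt (Finset.sum_le_sum fun k _ => ?_)
    by_cases hk : k = l
    · subst hk
      simp [hw, hl, sq_nonneg]
    · simp [hw, hk]
  have hrp : Real.sqrt (D.p / μ) * Real.sqrt D.p = q := by
    rw [← Real.sqrt_mul (by positivity), hq]
    congr 1
    ring
  have hδ : ‖β - w - β₀‖ * (C * Real.sqrt D.p) ≤ K * C * q := by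
    refine (mul_le_mul_of_nonneg_right (hnorm.trans hβ) hR0).trans (le_of_eq ?_)
    rw [← hrp]
    ring
  have hwZ : ∀ y, |inner ℝ w (D.cov y)| ≤ |β l| * C := fun y => by
    rw [hw, EuclideanSpace.inner_single_left, abs_mul]
    refine mul_le_mul (by simp) (D.abs_cov_apply_le hC0 hC y l) (abs_nonneg _) (abs_nonneg _)
  have h1 := canonicalLoglik_add_sub_le_of_near (ν := ν) (β₀ := β₀) (c := c) (S := S)
    D.measurable_cov hR hδ hsmall hwZ
  rw [← hℓ, sub_add_cancel, hν] at h1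
  have hin : inner ℝ w (S - ∫ y, D.cov y ∂ν) ≤ |β l| * (B * Real.sqrt (D.p * μ)) := by
    refine (real_inner_le_norm _ _).trans ?_
    have hwn : ‖w‖ = |β l| := by rw [hw, PiLp.norm_single, Real.norm_eq_abs]
    rw [hwn]
    exact mul_le_mul_of_nonneg_left hscore (abs_nonneg _)
  have hsq : Real.sqrt (D.p * μ) ≤ q * μ := by
    refine Real.sqrt_le_iff.2 ⟨by positivity, ?_⟩
    rw [mul_pow, hqsq]
    have : (D.p : ℝ) ^ 2 / μ * μ ^ 2 = (D.p : ℝ) ^ 2 * μ := by field_simp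
    rw [this]
    exact mul_le_mul_of_nonneg_right (le_self_pow₀ hpr two_ne_zero) hμ.le
  have hdl : D.loglik Y β - D.loglik Y (β - w) ≤ |β l| * ((B + 2 * K * C ^ 2) * q) * μ := by
    have h2 : |β l| * (B * Real.sqrt (D.p * μ)) ≤ |β l| * (B * (q * μ)) := by gcongr
    refine h1.trans ((add_le_add_left (hin.trans h2) _).trans (le_of_eq ?_))
    ring
  have hpen := Design.le_penalty_sub_penalty_removed (lamG := lamG) (lamL := lamL) β l
  rw [← hw] at hpen
  have hobj := hmax (Set.mem_univ (β - w))
  simp only [Set.mem_ofPred_eq, Design.objective_eq] at hobj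
  have h3 : μ⁻¹ * (D.loglik Y β - D.loglik Y (β - w)) ≤ |β l| * ((B + 2 * K * C ^ 2) * q) := by
    rw [inv_mul_le_iff₀ hμ]
    linarith
  have h4 : |β l| * ((B + 2 * K * C ^ 2) * q) < |β l| * lamL l :=
    mul_lt_mul_of_pos_left hlam (abs_pos.2 hne)
  linarith

end Deterministic

/-! ### Probabilities of the favourable events -/

theorem IsLittleOPOne.eventually_measure_le {Ω : ℕ → Type*} [∀ n, MeasurableSpace (Ω n)]
    {P : ∀ n, Measure (Ω n)} {X : ∀ n, Ω n → ℝ≥0∞} (h : IsLittleOPOne P X) {a ε : ℝ≥0∞}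
    (ha : 0 < a) (hε : 0 < ε) : ∀ᶠ n in atTop, P n {ω | a ≤ X n ω} ≤ ε :=
  (h a ha).eventually_le_const hε

theorem coe_mul_le_one_of_lt {a : ℝ≥0} {x : ℝ}
    (h : (a : ℝ≥0∞) * ENNReal.ofReal x < 1) : (a : ℝ) * x ≤ 1 := by
  rw [← ENNReal.ofReal_coe_nnreal, ← ENNReal.ofReal_mul NNReal.zero_le_coe, ENNReal.ofReal_lt_one] at h
  exact h.le

/-- In `[0, ∞]`, a small value of `q / inf_l λ_l` bounds every `λ_l` from below; `λ_l = 0` is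
excluded because then `q / inf_l λ_l = ∞`. -/
theorem mul_lt_of_inv_inf_mul_lt {ι : Type*} {s : Finset ι} {lam : ι → ℝ≥0} {q A : ℝ} (hq : 0 < q)
    (hA : 0 < A) (h : (s.inf fun l => (lam l : ℝ≥0∞))⁻¹ * ENNReal.ofReal q < ENNReal.ofReal A⁻¹)
    {l : ι} (hl : l ∈ s) : A * q < lam l := by
  have h1 : ((lam l : ℝ≥0∞))⁻¹ ≤ (s.inf fun l => (lam l : ℝ≥0∞))⁻¹ :=
    ENNReal.inv_le_inv.2 (Finset.inf_le hl)
  have h2 : ((lam l : ℝ≥0∞))⁻¹ * ENNReal.ofReal q < ENNReal.ofReal A⁻¹ :=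
    (mul_le_mul_left h1 _).trans_lt h
  have hq' : ENNReal.ofReal q ≠ 0 := by simpa using hq
  have hpos : lam l ≠ 0 := fun h0 => by
    rw [h0, ENNReal.coe_zero, ENNReal.inv_zero, ENNReal.top_mul hq'] at h2
    exact absurd h2 not_top_lt
  rw [← ENNReal.coe_inv hpos, ← ENNReal.ofReal_coe_nnreal, ← ENNReal.ofReal_mul NNReal.zero_le_coe,
    ENNReal.ofReal_lt_ofReal_iff (inv_pos.2 hA), NNReal.coe_inv] at h2
  have hlpos : (0 : ℝ) < lam l := by
    have : 0 < lam l := pos_iff_ne_zero.2 hpos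
    exact_mod_cast this
  rw [inv_mul_lt_iff₀ hlpos, lt_mul_inv_iff₀ hA] at h2
  linarith

/-! ### Consistency and sparsity -/

theorem negHessianForm_eq {d M : ℕ} {D : Design d M} {Y : Set (MarkedPoint d M)}
    (hfin : (Y ∩ D.window).Finite) (β₀ φ : D.Param) [IsFiniteMeasure (D.intensityMeasure β₀)]
    {C : ℝ} (hC0 : 0 ≤ C) (hC : ∀ l x, |D.z l x| ≤ C) :
    D.negHessianForm Y β₀ φ = ∫ y, (inner ℝ φ (D.cov y)) ^ 2 ∂(D.intensityMeasure β₀) := by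
  unfold Design.negHessianForm
  rw [Design.loglik_eq_canonicalLoglik hfin β₀,
    fderiv_fderiv_canonicalLoglik D.measurable_cov (D.norm_cov_le hC0 hC), neg_neg]

theorem tendsto_sqrt_sq_div_of_pow_four {p : ℕ → ℕ} {μ : ℕ → ℝ} (hμ : Tendsto μ atTop atTop)
    (h : Tendsto (fun n => (p n : ℝ) ^ 4 / μ n) atTop (𝓝 0)) :
    Tendsto (fun n => Real.sqrt ((p n : ℝ) ^ 2 / μ n)) atTop (𝓝 0) := by
  rw [← Real.sqrt_zero]
  refine (Real.continuous_sqrt.tendsto 0).comp ?_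
  refine squeeze_zero' ?_ ?_ h
  · filter_upwards [hμ.eventually_gt_atTop 0] with n hn
    positivity
  · filter_upwards [hμ.eventually_gt_atTop 0] with n hn
    refine div_le_div_of_nonneg_right ?_ hn.le
    have : (p n) ^ 2 ≤ (p n) ^ 4 := by
      rcases Nat.eq_zero_or_pos (p n) with h0 | h0
      · simp [h0]
      · exact Nat.pow_le_pow_right h0 (by norm_num)
    exact_mod_cast this

/-- With probability at least `1 - ε`, for large `n` the estimator lies within `K √(p/μ)` of the
true parameter and vanishes at all inactive coefficients. -/
theorem exists_eventually_measure_not_le {d M : ℕ} {Ω : ℕ → Type*} [∀ n, MeasurableSpace (Ω n)]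
    {P : ∀ n, Measure (Ω n)} [∀ n, IsProbabilityMeasure (P n)]
    {D : ℕ → Design d M} {βstar : ∀ n, (D n).Param} {Y : ∀ n, Ω n → Set (MarkedPoint d M)}
    (hY : ∀ n, IsPointProcess (Y n))
    (hρ : ∀ n, HasIntensity (P n) (Y n) (D n).window ((D n).rho (βstar n)))
    {g : ℕ → MarkedPoint d M → MarkedPoint d M → ℝ}
    (hg : ∀ n, HasPairCorrelation (P n) (Y n) (D n).window ((D n).rho (βstar n)) (g n))
    {lamG : ∀ n, Ω n → Fin (D n).G → ℝ≥0} {lamL : ∀ n, Ω n → (D n).Coef → ℝ≥0}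
    (hreg : RegularityConditions P D βstar Y g)
    (hpen : PenaltyConditions P D βstar Y lamG lamL)
    {βhat : ∀ n, Ω n → (D n).Param}
    (hβhat : ∀ n (ω : Ω n),
      (∃ β, IsMaxOn ((D n).objective (meanPoints (P n) (D n) (Y n))
        (lamG n ω) (lamL n ω) (Y n ω)) Set.univ β) →
      IsMaxOn ((D n).objective (meanPoints (P n) (D n) (Y n))
        (lamG n ω) (lamL n ω) (Y n ω)) Set.univ (βhat n ω))
    {ε : ℝ} (hε : 0 < ε) :
    ∃ K : ℝ, ∀ᶠ n in atTop, P n {ω | ¬ (‖βhat n ω - βstar n‖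
        ≤ K * Real.sqrt ((D n).p / meanPoints (P n) (D n) (Y n)) ∧
      ∀ l ∈ (D n).inactive (βstar n), βhat n ω l = 0)} ≤ ENNReal.ofReal ε := by
  obtain ⟨C₀, hC₀⟩ := hreg.z_bounded
  set C := |C₀| with hCdef
  have hC0 : 0 ≤ C := abs_nonneg _
  have hC : ∀ n l x, |(D n).z l x| ≤ C := fun n l x => (hC₀ n l x).trans (le_abs_self _)
  obtain ⟨V₀, hV₀⟩ := hreg.pair_correlation βstar (by
    simp only [sub_self, norm_zero]
    exact Asymptotics.isBigO_zero _ _)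
  set V := max V₀ 0 with hVdef
  have hV0 : 0 ≤ V := le_max_right _ _
  obtain ⟨α, hα, hsens⟩ := hreg.sensitivity
  -- `B` makes the tail bound of the score `ε / 4`; `K` then makes the quadratic term dominate
  set B := Real.sqrt (4 * C ^ 2 * (1 + V) / ε) + 1 with hBdef
  have hB : 0 < B := by positivity
  have hBε : C ^ 2 * (1 + V) / B ^ 2 ≤ ε / 4 := by
    have h1 : 4 * C ^ 2 * (1 + V) / ε ≤ B ^ 2 := by
      rw [← Real.sq_sqrt (show 0 ≤ 4 * C ^ 2 * (1 + V) / ε by positivity)]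
      exact pow_le_pow_left₀ (Real.sqrt_nonneg _) (by rw [hBdef]; linarith) 2
    rw [div_le_iff₀ hε] at h1
    rw [div_le_iff₀ (by positivity)]
    linarith
  set K := 4 * (B + 3) / α with hKdef
  have hK0 : 0 < K := by positivity
  have hK : 4 * (B + 2) < α * K := by
    rw [hKdef, mul_div_cancel₀ _ hα.ne']
    linarith
  set A := B + 2 * K * C ^ 2 with hAdef
  have hA : 0 < A := by positivity
  have hε4 : 0 < ENNReal.ofReal (ε / 4) := ENNReal.ofReal_pos.2 (by positivity)
  have hqt : Tendsto (fun n => K * C * Real.sqrt (((D n).p : ℝ) ^ 2 /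
      meanPoints (P n) (D n) (Y n))) atTop (𝓝 0) := by
    simpa using (tendsto_sqrt_sq_div_of_pow_four hreg.mean_tendsto hreg.dim_tendsto).const_mul
      (K * C)
  refine ⟨K, ?_⟩
  filter_upwards [hreg.mean_tendsto.eventually_gt_atTop 0, hV₀,
    hqt.eventually_le_const one_pos,
    hpen.coef_active.eventually_measure_le one_pos hε4,
    hpen.group_active.eventually_measure_le one_pos hε4,
    hpen.coef_inactive.eventually_measure_le (ENNReal.ofReal_pos.2 (inv_pos.2 hA)) hε4]
    with n hμ hVn hsmall hE2 hE3 hE4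
  set μ := meanPoints (P n) (D n) (Y n) with hμdef
  rcases Nat.eq_zero_or_pos (D n).p with hp0 | hp
  · -- without parameters there is nothing to estimate
    have hempty : IsEmpty (D n).Coef := by
      rw [← Fintype.card_eq_zero_iff, (D n).card_coef, hp0]
    refine le_trans (le_of_eq ?_) zero_le
    refine measure_mono_null (fun ω hω => hω ⟨?_, fun l => (hempty.false l).elim⟩) measure_empty
    rw [Subsingleton.elim (βhat n ω) (βstar n), sub_self, norm_zero]
    positivity
  have hfinν := isFiniteMeasure_intensityMeasure (hρ n) hμ
  have hE1 : P n {ω | B * Real.sqrt ((D n).p * μ) < ‖score (D n) (hY n) (βstar n) ω‖}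
      ≤ ENNReal.ofReal (ε / 4) := by
    refine (measure_norm_score_gt_le (hY n) (hρ n) (hg n) hμ hμdef hp hC0 (hC n) hV0 hB ?_).trans
      (ENNReal.ofReal_le_ofReal hBε)
    exact hVn.trans (ENNReal.ofReal_le_ofReal
      (mul_le_mul_of_nonneg_right (le_max_left _ _) hμ.le))
  have hsum : ENNReal.ofReal ε = ENNReal.ofReal (ε / 4) + ENNReal.ofReal (ε / 4)
      + (ENNReal.ofReal (ε / 4) + ENNReal.ofReal (ε / 4)) := by
    rw [← ENNReal.ofReal_add (by positivity) (by positivity),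
      ← ENNReal.ofReal_add (by positivity) (by positivity)]
    congr 1
    ring
  rw [hsum]
  refine le_trans ?_ (add_le_add (add_le_add hE1 hE2) (add_le_add hE3 hE4))
  refine le_trans (measure_mono ?_) ((measure_union_le _ _).trans
    (add_le_add (measure_union_le _ _) (measure_union_le _ _)))
  intro ω hω
  by_contra hout
  simp only [Set.mem_union, Set.mem_ofPred_eq, not_or, not_le, not_lt] at hout
  obtain ⟨⟨h1, h2⟩, h3, h4⟩ := hout
  refine hω ?_
  have hfin := (hY n).finite_inter_window (D := D n) ω
  have hℓ := (D n).loglik_eq_canonicalLoglik hfin (βstar n)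
  have hsensω : ∀ φ : (D n).Param, ‖φ‖ = 1 →
      α * μ ≤ ∫ y, (inner ℝ φ ((D n).cov y)) ^ 2 ∂((D n).intensityMeasure (βstar n)) := by
    intro φ hφ
    rw [← negHessianForm_eq hfin (βstar n) φ hC0 (hC n)]
    have := hsens n ω φ hφ
    rwa [← hμdef, le_inv_mul_iff₀ hμ, mul_comm] at this
  have hR := (D n).norm_cov_le hC0 (hC n)
  have hcont : Continuous ((D n).objective μ (lamG n ω) (lamL n ω) (Y n ω)) := by
    have h := ((continuous_canonicalLoglik (ν := (D n).intensityMeasure (βstar n))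
      (β₀ := βstar n) (c := ∑ y ∈ hfin.toFinset, Real.log ((D n).base y.1))
      (S := ∑ y ∈ hfin.toFinset, (D n).cov y) (D n).measurable_cov hR).const_mul μ⁻¹).sub
      (Design.continuous_penalty (lamG := lamG n ω) (lamL := lamL n ω))
    rw [← hℓ] at h
    exact h.congr fun β => (Design.objective_eq μ (Y n ω) β).symm
  have hconc : ConcaveOn ℝ Set.univ ((D n).objective μ (lamG n ω) (lamL n ω) (Y n ω)) := by
    have h := ((concaveOn_canonicalLoglik (ν := (D n).intensityMeasure (βstar n))
      (β₀ := βstar n) (c := ∑ y ∈ hfin.toFinset, Real.log ((D n).base y.1))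
      (S := ∑ y ∈ hfin.toFinset, (D n).cov y) (D n).measurable_cov hR).smul
        (inv_nonneg.2 hμ.le)).sub
      (Design.convexOn_penalty (lamG := lamG n ω) (lamL := lamL n ω))
    rw [← hℓ] at h
    exact h.congr fun β _ => (Design.objective_eq μ (Y n ω) β).symm
  have hpr : (0 : ℝ) < (D n).p := by exact_mod_cast hp
  obtain ⟨hex, hloc⟩ := exists_isMaxOn_and_norm_lt_of_sphere hcont hconc (x₀ := βstar n)
    (r := K * Real.sqrt ((D n).p / μ)) (by positivity)
    fun u hu => objective_lt_on_sphere hp hμ hC0 (hC n) hK0 hℓ hsensω h1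
      (coe_mul_le_one_of_lt h3) (coe_mul_le_one_of_lt h2) hK hsmall hu
  have hmax := hβhat n ω hex
  have hβ := (hloc _ hmax).le
  refine ⟨hβ, fun l hl => ?_⟩
  have hl0 : βstar n l = 0 := (Finset.mem_filter.1 hl).2
  exact apply_eq_zero_of_isMaxOn hp hμ hC0 (hC n) hB.le
    (real_univ_intensityMeasure (hρ n)) hℓ h1 hsmall hmax hβ hl0
    (mul_lt_of_inv_inf_mul_lt (Real.sqrt_pos.2 (by positivity)) hA h4 hl)

end SparseGroupLassoPP

theorem mainTheorem1 {d M : ℕ} {Ω : ℕ → Type*} [∀ n, MeasurableSpace (Ω n)]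
    (P : ∀ n, Measure (Ω n)) [∀ n, IsProbabilityMeasure (P n)]
    -- the model, the true parameter and the point process, at each index `n`
    (D : ℕ → SparseGroupLassoPP.Design d M)
    (βstar : ∀ n, (D n).Param)
    (Y : ∀ n, Ω n → Set (SparseGroupLassoPP.MarkedPoint d M))
    (hY : ∀ n, SparseGroupLassoPP.IsPointProcess (Y n))
    (hρ : ∀ n, SparseGroupLassoPP.HasIntensity (P n) (Y n) (D n).window ((D n).rho (βstar n)))
    (g : ℕ → SparseGroupLassoPP.MarkedPoint d M → SparseGroupLassoPP.MarkedPoint d M → ℝ)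
    (hg : ∀ n, SparseGroupLassoPP.HasPairCorrelation (P n) (Y n) (D n).window
      ((D n).rho (βstar n)) (g n))
    -- the nonnegative, possibly random, regularization parameters
    (lamG : ∀ n, Ω n → Fin (D n).G → ℝ≥0)
    (lamL : ∀ n, Ω n → (D n).Coef → ℝ≥0)
    (hreg : SparseGroupLassoPP.RegularityConditions P D βstar Y g)
    (hpen : SparseGroupLassoPP.PenaltyConditions P D βstar Y lamG lamL)
    -- the estimator maximizes the criterion over the parameter space whenever a maximizer exists
    (βhat : ∀ n, Ω n → (D n).Param)
    (hβhat : ∀ n (ω : Ω n),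
      (∃ β, IsMaxOn ((D n).objective (SparseGroupLassoPP.meanPoints (P n) (D n) (Y n))
        (lamG n ω) (lamL n ω) (Y n ω)) Set.univ β) →
      IsMaxOn ((D n).objective (SparseGroupLassoPP.meanPoints (P n) (D n) (Y n))
        (lamG n ω) (lamL n ω) (Y n ω)) Set.univ (βhat n ω)) :
    SparseGroupLassoPP.IsBigOP P (fun n ω => ‖βhat n ω - βstar n‖)
        (fun n => Real.sqrt ((D n).p / SparseGroupLassoPP.meanPoints (P n) (D n) (Y n))) ∧
      Tendsto (fun n => P n {ω | ∀ l ∈ (D n).inactive (βstar n), βhat n ω l = 0})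
        atTop (𝓝 1) := by
  have key := fun (ε : ℝ) (hε : 0 < ε) =>
    SparseGroupLassoPP.exists_eventually_measure_not_le hY hρ hg hreg hpen hβhat hε
  refine ⟨fun ε hε => ?_, ?_⟩
  · obtain ⟨K, hK⟩ := key ε hε
    refine ⟨K, hK.mono fun n hn => (measure_mono fun ω hω => ?_).trans hn⟩
    rintro ⟨h, -⟩
    have hω' : K * Real.sqrt ((D n).p / SparseGroupLassoPP.meanPoints (P n) (D n) (Y n))
        < |‖βhat n ω - βstar n‖| := hω
    rw [abs_of_nonneg (norm_nonneg _)] at hω'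
    exact absurd h (not_le.2 hω')
  · refine (ENNReal.tendsto_nhds ENNReal.one_ne_top).2 fun ε hε => ?_
    have hε1 : min ε 1 ≠ ⊤ := ((min_le_right _ _).trans_lt ENNReal.one_lt_top).ne
    obtain ⟨K, hK⟩ := key (min ε 1).toReal
      (ENNReal.toReal_pos (lt_min hε one_pos).ne' hε1)
    refine hK.mono fun n hn => ⟨?_, prob_le_one.trans le_self_add⟩
    rw [ENNReal.ofReal_toReal hε1] at hn
    rw [tsub_le_iff_right, ← measure_univ (μ := P n)]
    refine le_trans (measure_mono fun ω _ => ?_) ((measure_union_le _ _).trans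
      (add_le_add le_rfl (hn.trans (min_le_left _ _))))
    by_cases h : ∀ l ∈ (D n).inactive (βstar n), βhat n ω l = 0
    · exact Or.inl h
    · exact Or.inr fun hgood => h hgood.2
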